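/- Let $n,p,m\ge 0$ be integers with $n>p+1$ and $n>p-m+2$. Let $X$ be a random $n\times p$ matrix whose rows $x_1,\dots,x_n$ are i.i.d. $N(0,\Sigma_0)$ with $\Sigma_0$ positive definite, and let $y=X\beta_0+\epsilon$, where $\beta_0\in\mathbb R^p$ and $\epsilon$ is independent of $X$ with i.i.d. $N(0,\sigma_0^2)$ entries, $\sigma_0^2>0$. Let $R\in\mathbb R^{m\times p}$ have rank $m$, let $r\in\mathbb R^m$, and assume that the true model satisfies the restrictions, $R\beta_0=r$. For $\beta\in\mathbb R^p$, $\sigma^2>0$ and $\Sigma$ positive definite, let $f(y,X\mid\beta,\sigma^2,\Sigma)$ be the density of a sample of size $n$ with rows of $X$ i.i.d. $N(0,\Sigma)$ and $y\mid X\sim N(X\beta,\sigma^2 I_n)$: $$-2\log f(y,X\mid\beta,\sigma^2,\Sigma)=n\log(2\pi\sigma^2)+\frac{\|y-X\beta\|_2^2}{\sigma^2}+np\log(2\pi)+n\log|\Sigma|+\sum_{i=1}^n x_i^T\Sigma^{-1}x_i .$$ Then almost surely there is exactly one joint maximum likelihood estimator $(\hat\beta,\hat\sigma^2,\hat\Sigma)$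 subject to $R\beta=r$, namely $$\hat\beta=\hat\beta^f+(X^TX)^{-1}R^T\big(R(X^TX)^{-1}R^T\big)^{-1}(r-R\hat\beta^f),\qquad \hat\sigma^2=\tfrac1n\mathrm{RSS}(R,r),\qquad \hat\Sigma=\tfrac1n X^TX,$$ where $\hat\beta^f=(X^TX)^{-1}X^Ty$ and $\mathrm{RSS}(R,r)=\|y-X\hat\beta\|_2^2$. Let $(X^{(n)},y^{(n)})$ be an independent copy of $(X,y)$, and let $$\mathrm{errR}=-2\log f(y,X\mid\hat\beta,\hat\sigma^2,\hat\Sigma),\qquad \mathrm{ErrR}=E_{X^{(n)},y^{(n)}}\big[-2\log f(y^{(n)},X^{(n)}\mid\hat\beta,\hat\sigma^2,\hat\Sigma)\big],\qquad \mathrm{optR}=\mathrm{ErrR}-\mathrm{errR}$$ be the Kullback--Leibler training error, test error and optimism; in $\mathrm{ErrR}$ the expectation is over the new sample only. All expectations here are finite, and $$E_{X,y}(\mathrm{optR})=n\,\frac{n(n-1)}{(n-p+m-2)(n-p+m-1)}+n\,\frac{np}{n-p-1}-n(p+1).$$ Consequently, with $$\mathrm{RAICc}(R,r)=n\log\frac{\mathrm{RSS}(R,r)}{n}+n\,\frac{n(n-1)}{(n-p+m-2)(n-p+m-1)},$$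 almost surely $$\mathrm{errR}+E_{X,y}(\mathrm{optR})=\mathrm{RAICc}(R,r)+n(p+1)\log(2\pi)+n\,\frac{np}{n-p-1}+n\log|\hat\Sigma| ,$$ where the last three terms do not depend on the restrictions, and this quantity is an unbiased estimator of $E_{X,y}(\mathrm{ErrR})$. -/

import Mathlib

open MeasureTheory ProbabilityTheory
open scoped Matrix

noncomputable section

namespace RandomX

/-- The parameters `(β, σ², Σ)` of the joint Gaussian model for `(y, X)`. -/
@[ext]
structure Params (p : ℕ) where
  β : Fin p → ℝ
  var : ℝ
  cov : Matrix (Fin p) (Fin p) ℝ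

variable {n p m : ℕ}

/-- The design: the rows `x i` are i.i.d. `N(0, S)`, the errors `ε i` are i.i.d. `N(0, v)`, and
the vector of errors is independent of the design matrix. -/
structure IsGaussianDesign {Ω : Type*} [MeasurableSpace Ω] (P : Measure Ω)
    (x : Fin n → Ω → EuclideanSpace ℝ (Fin p)) (ε : Fin n → Ω → ℝ)
    (S : Matrix (Fin p) (Fin p) ℝ) (v : ℝ) : Prop where
  law_row : ∀ i, HasLaw (x i) (multivariateGaussian 0 S) P
  indep_rows : iIndepFun x P
  law_err : ∀ i, HasLaw (ε i) (gaussianReal 0 v.toNNReal) P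
  indep_errs : iIndepFun ε P
  indep : IndepFun (fun ω i => x i ω) (fun ω i => ε i ω) P

/-- The random `n × p` design matrix with rows `x i`. -/
def design {Ω : Type*} (x : Fin n → Ω → EuclideanSpace ℝ (Fin p)) (ω : Ω) :
    Matrix (Fin n) (Fin p) ℝ :=
  Matrix.of fun i j => x i ω j

/-- The response `y = X β₀ + ε`. -/
def response {Ω : Type*} (x : Fin n → Ω → EuclideanSpace ℝ (Fin p)) (ε : Fin n → Ω → ℝ)
    (β₀ : Fin p → ℝ) (ω : Ω) : Fin n → ℝ :=
  fun i => (design x ω *ᵥ β₀) i + ε i ω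

/-- The density of `N(0, S)` on `ℝᵖ`. -/
def rowDensity (S : Matrix (Fin p) (Fin p) ℝ) (x : Fin p → ℝ) : ℝ :=
  (√((2 * Real.pi) ^ p * S.det))⁻¹ * Real.exp (-(x ⬝ᵥ (S⁻¹ *ᵥ x)) / 2)

/-- The joint density of one observation `(y, x)`: the conditional density of `y` given `x`, which
is that of `N(xᵀβ, σ²)`, times the marginal density of `x`. -/
def obsDensity (θ : Params p) (y : ℝ) (x : Fin p → ℝ) : ℝ :=
  gaussianPDFReal (x ⬝ᵥ θ.β) θ.var.toNNReal y * rowDensity θ.cov x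

/-- `-2 log f(y, X | β, σ², Σ)` for a sample of `n` independent observations. -/
def negTwoLogLik (X : Matrix (Fin n) (Fin p) ℝ) (y : Fin n → ℝ) (θ : Params p) : ℝ :=
  -2 * Real.log (∏ i, obsDensity θ (y i) (X i))

/-- The parameters of the approximating model under the restrictions `R β = r`. -/
def restrictedParams (R : Matrix (Fin m) (Fin p) ℝ) (r : Fin m → ℝ) : Set (Params p) :=
  {θ | R *ᵥ θ.β = r ∧ 0 < θ.var ∧ θ.cov.PosDef}

/-- `θ` is a joint maximum likelihood estimate under the restrictions `R β = r`. -/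
def IsRestrictedMLE (R : Matrix (Fin m) (Fin p) ℝ) (r : Fin m → ℝ)
    (X : Matrix (Fin n) (Fin p) ℝ) (y : Fin n → ℝ) (θ : Params p) : Prop :=
  θ ∈ restrictedParams R r ∧ IsMinOn (negTwoLogLik X y) (restrictedParams R r) θ

/-- The unrestricted least squares estimator `(XᵀX)⁻¹ Xᵀ y`. -/
def betaFull (X : Matrix (Fin n) (Fin p) ℝ) (y : Fin n → ℝ) : Fin p → ℝ :=
  (Xᵀ * X)⁻¹ *ᵥ (Xᵀ *ᵥ y)

/-- The restricted least squares estimator. -/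
def betaHat (R : Matrix (Fin m) (Fin p) ℝ) (r : Fin m → ℝ)
    (X : Matrix (Fin n) (Fin p) ℝ) (y : Fin n → ℝ) : Fin p → ℝ :=
  betaFull X y +
    ((Xᵀ * X)⁻¹ * Rᵀ * (R * (Xᵀ * X)⁻¹ * Rᵀ)⁻¹) *ᵥ (r - R *ᵥ betaFull X y)

/-- The residual sum of squares `RSS(R, r) = ‖y - X β̂‖²`. -/
def rss (R : Matrix (Fin m) (Fin p) ℝ) (r : Fin m → ℝ)
    (X : Matrix (Fin n) (Fin p) ℝ) (y : Fin n → ℝ) : ℝ :=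
  ∑ i, (y i - (X *ᵥ betaHat R r X y) i) ^ 2

/-- The closed form of the joint restricted MLE `(β̂, σ̂², Σ̂)`. -/
def mle (R : Matrix (Fin m) (Fin p) ℝ) (r : Fin m → ℝ)
    (X : Matrix (Fin n) (Fin p) ℝ) (y : Fin n → ℝ) : Params p where
  β := betaHat R r X y
  var := rss R r X y / n
  cov := (n : ℝ)⁻¹ • (Xᵀ * X)

/-- The training error `errR_KL`. -/
def trainErr (R : Matrix (Fin m) (Fin p) ℝ) (r : Fin m → ℝ)
    (X : Matrix (Fin n) (Fin p) ℝ) (y : Fin n → ℝ) : ℝ :=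
  negTwoLogLik X y (mle R r X y)

/-- The test error `ErrR_KL` of the model fitted to `(X, y)`: the expectation of `-2 log f` at a new
sample `(X', y')`, the fitted parameters being held fixed. The new sample lives on its own
probability space, so it is independent of the training sample. -/
def testErr {Ω : Type*} [MeasurableSpace Ω] (P' : Measure Ω)
    (X' : Ω → Matrix (Fin n) (Fin p) ℝ) (y' : Ω → Fin n → ℝ)
    (R : Matrix (Fin m) (Fin p) ℝ) (r : Fin m → ℝ)
    (X : Matrix (Fin n) (Fin p) ℝ) (y : Fin n → ℝ) : ℝ :=
  ∫ ω', negTwoLogLik (X' ω') (y' ω') (mle R r X y) ∂P'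

/-- The optimism `optR_KL = ErrR_KL - errR_KL`. -/
def optimism {Ω : Type*} [MeasurableSpace Ω] (P' : Measure Ω)
    (X' : Ω → Matrix (Fin n) (Fin p) ℝ) (y' : Ω → Fin n → ℝ)
    (R : Matrix (Fin m) (Fin p) ℝ) (r : Fin m → ℝ)
    (X : Matrix (Fin n) (Fin p) ℝ) (y : Fin n → ℝ) : ℝ :=
  testErr P' X' y' R r X y - trainErr R r X y

/-- The criterion `RAICc(R, r)`. -/
def raicc (R : Matrix (Fin m) (Fin p) ℝ) (r : Fin m → ℝ)
    (X : Matrix (Fin n) (Fin p) ℝ) (y : Fin n → ℝ) : ℝ :=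
  n * Real.log (rss R r X y / n) +
    n * ((n * (n - 1)) / (((n : ℝ) - p + m - 2) * ((n : ℝ) - p + m - 1)))

/-- The part of the unbiased estimator of the test error that does not involve the restrictions:
`n (p + 1) log (2π) + n · np / (n - p - 1) + n log |Σ̂|`, where `Σ̂ = XᵀX / n`. -/
def restrictionFree (X : Matrix (Fin n) (Fin p) ℝ) : ℝ :=
  n * (p + 1) * Real.log (2 * Real.pi) + n * ((n * p) / ((n : ℝ) - p - 1)) +
    n * Real.log ((n : ℝ)⁻¹ • (Xᵀ * X)).det

end RandomX

end

open RandomX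

/-!
Subject to `R β = r`, the residual `y - X β̂` is orthogonal to `X (β - β̂)`. Hence `-2 log f`
exceeds its value at `(β̂, σ̂², Σ̂)` by the sum of three nonnegative terms, each of which vanishes
only at the corresponding estimate: `‖X (β - β̂)‖² / σ²`, `n` times `t - 1 - log t` at
`t = σ̂² / σ²`, and `n` times Stein's loss of `Σ` and `Σ̂`.

For a new sample, `E (-2 log f)` depends on the training sample only through
`(σ₀² + (β̂ - β₀)ᵀ Σ₀ (β̂ - β₀)) / RSS`, the trace of `(XᵀX)⁻¹ Σ₀` and terms that cancel against the
training error. Since `R β₀ = r`, the error `β̂ - β₀` lies in the kernel of `R`. For a basis `N` of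
that kernel with `Nᵀ Σ₀ N = 1`, restricted least squares becomes ordinary least squares of `ε` on
`X N`, which is an `n × (p - m)` matrix of independent standard Gaussians. For a fixed design the
estimator and the residual sum of squares are independent, the latter being chi-squared, so
everything reduces to the means of an inverse chi-squared variable and of the trace of an inverse
Wishart matrix. The latter follows from the former, as a diagonal entry of `(UᵀU)⁻¹` is the inverse
of the residual sum of squares of a column of `U` regressed on the others.
-/

namespace RandomX

section HasIntegral

variable {α α' ι : Type*} {mα : MeasurableSpace α} {mα' : MeasurableSpace α'} {μ : Measure α}
  {ν : Measure α'} {f g : α → ℝ} {a b : ℝ}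

/-- `f` is integrable with integral `c`. Moments are stated in this form because the Bochner
integral of a function that is not integrable is `0`. -/
def HasIntegral (f : α → ℝ) (c : ℝ) (μ : Measure α) : Prop :=
  Integrable f μ ∧ ∫ t, f t ∂μ = c

theorem HasIntegral.add (hf : HasIntegral f a μ) (hg : HasIntegral g b μ) :
    HasIntegral (fun t => f t + g t) (a + b) μ :=
  ⟨hf.1.add hg.1, by rw [integral_add hf.1 hg.1, hf.2, hg.2]⟩

theorem HasIntegral.sub (hf : HasIntegral f a μ) (hg : HasIntegral g b μ) :
    HasIntegral (fun t => f t - g t) (a - b) μ :=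
  ⟨hf.1.sub hg.1, by rw [integral_sub hf.1 hg.1, hf.2, hg.2]⟩

theorem HasIntegral.const_mul (c : ℝ) (hf : HasIntegral f a μ) :
    HasIntegral (fun t => c * f t) (c * a) μ :=
  ⟨hf.1.const_mul c, by rw [integral_const_mul, hf.2]⟩

theorem HasIntegral.sum {s : Finset ι} {f : ι → α → ℝ} {c : ι → ℝ}
    (hf : ∀ i ∈ s, HasIntegral (f i) (c i) μ) :
    HasIntegral (fun t => ∑ i ∈ s, f i t) (∑ i ∈ s, c i) μ :=
  ⟨integrable_finsetSum _ fun i hi => (hf i hi).1, by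
    rw [integral_finsetSum _ fun i hi => (hf i hi).1]
    exact Finset.sum_congr rfl fun i hi => (hf i hi).2⟩

theorem hasIntegral_const [IsProbabilityMeasure μ] (c : ℝ) : HasIntegral (fun _ => c) c μ :=
  ⟨integrable_const c, by simp⟩

theorem HasIntegral.congr (hf : HasIntegral f a μ) (h : f =ᵐ[μ] g) : HasIntegral g a μ :=
  ⟨hf.1.congr h, by rw [← integral_congr_ae h, hf.2]⟩

theorem HasIntegral.comp_hasLaw {X : α' → α} (hf : HasIntegral f a μ) (hX : HasLaw X μ ν) :
    HasIntegral (fun ω => f (X ω)) a ν := by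
  have hmap : HasIntegral f a (ν.map X) := by rwa [hX.map_eq]
  refine ⟨hmap.1.comp_aemeasurable hX.aemeasurable, ?_⟩
  rw [← integral_map hX.aemeasurable hmap.1.aestronglyMeasurable, hmap.2]

theorem HasIntegral.of_comp_hasLaw {X : α' → α} (hX : HasLaw X μ ν)
    (hf : AEStronglyMeasurable f μ) (h : HasIntegral (fun ω => f (X ω)) a ν) :
    HasIntegral f a μ := by
  rw [← hX.map_eq] at hf ⊢
  exact ⟨(integrable_map_measure hf hX.aemeasurable).2 h.1, by
    rw [integral_map hX.aemeasurable hf, h.2]⟩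

theorem HasIntegral.mul_of_indepFun (hf : HasIntegral f a μ) (hg : HasIntegral g b μ)
    (hindep : IndepFun f g μ) : HasIntegral (fun t => f t * g t) (a * b) μ :=
  ⟨hindep.integrable_mul hf.1 hg.1, by
    rw [hindep.integral_fun_mul_eq_mul_integral hf.1.1 hg.1.1, hf.2, hg.2]⟩

variable [SFinite μ] [SFinite ν]

theorem HasIntegral.mul_prod {g : α' → ℝ} (hf : HasIntegral f a μ)
    (hg : HasIntegral g b ν) : HasIntegral (fun t : α × α' => f t.1 * g t.2) (a * b) (μ.prod ν) :=
  ⟨hf.1.mul_prod hg.1, by rw [integral_prod_mul, hf.2, hg.2]⟩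

/-- Tonelli: nonnegativity makes integrability on the product automatic. -/
theorem HasIntegral.prod_of_nonneg {f : α × α' → ℝ} {g : α → ℝ}
    (hf : AEStronglyMeasurable f (μ.prod ν)) (hnonneg : ∀ t, 0 ≤ f t)
    (hinner : ∀ᵐ t ∂μ, HasIntegral (fun s => f (t, s)) (g t) ν) (hg : HasIntegral g a μ) :
    HasIntegral f a (μ.prod ν) := by
  have hinner_eq : (fun t => ∫ s, f (t, s) ∂ν) =ᵐ[μ] g := hinner.mono fun t ht => ht.2
  have hint : Integrable f (μ.prod ν) := by
    refine (integrable_prod_iff hf).2 ⟨hinner.mono fun t ht => ht.1, ?_⟩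
    simp only [Real.norm_of_nonneg (hnonneg _)]
    exact hg.1.congr hinner_eq.symm
  exact ⟨hint, by rw [integral_prod f hint, integral_congr_ae hinner_eq, hg.2]⟩

theorem HasIntegral.integral_prod_right {f : α × α' → ℝ} (hf : HasIntegral f a (μ.prod ν)) :
    HasIntegral (fun s => ∫ t, f (t, s) ∂μ) a ν :=
  ⟨hf.1.integral_prod_right, by rw [← integral_prod_symm f hf.1, hf.2]⟩

end HasIntegral

theorem posDef_mul_mul_transpose {ι κ : Type*} [Fintype ι] [Fintype κ] {A : Matrix ι ι ℝ}
    {B : Matrix κ ι ℝ} (hA : A.PosDef) (hB : Function.Injective B.vecMul) :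
    (B * A * Bᵀ).PosDef := by
  simpa only [Matrix.conjTranspose_eq_transpose_of_trivial] using
    hA.mul_mul_conjTranspose_same hB

section SteinLoss

variable {ι : Type*} [Fintype ι] [DecidableEq ι] {A B S : Matrix ι ι ℝ}

open scoped MatrixOrder in
theorem exists_eq_transpose_mul_self (hS : S.PosDef) :
    ∃ B : Matrix ι ι ℝ, IsUnit B ∧ S = Bᵀ * B := by
  obtain ⟨B, hB⟩ := CStarAlgebra.nonneg_iff_eq_star_mul_self.1 hS.posSemidef.nonneg
  rw [Matrix.star_eq_conjTranspose, Matrix.conjTranspose_eq_transpose_of_trivial] at hB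
  have hdet : 0 < B.det * B.det := by simpa [hB] using hS.det_pos
  exact ⟨B, (Matrix.isUnit_iff_isUnit_det B).2 (left_ne_zero_of_mul hdet.ne').isUnit, hB⟩

theorem sub_one_sub_log_nonneg {t : ℝ} (ht : 0 < t) : 0 ≤ t - 1 - Real.log t :=
  sub_nonneg.2 (Real.log_le_sub_one_of_pos ht)

theorem sub_one_sub_log_eq_zero_iff {t : ℝ} (ht : 0 < t) : t - 1 - Real.log t = 0 ↔ t = 1 := by
  refine ⟨fun h => ?_, by rintro rfl; simp⟩
  by_contra hne
  exact (sub_pos.2 (Real.log_lt_sub_one_of_pos ht hne)).ne' h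

theorem trace_sub_card_sub_log_det_eq_sum (hB : B.PosDef) :
    B.trace - Fintype.card ι - Real.log B.det =
      ∑ i, (hB.1.eigenvalues i - 1 - Real.log (hB.1.eigenvalues i)) := by
  have hlog : Real.log B.det = ∑ i, Real.log (hB.1.eigenvalues i) := by
    rw [hB.1.det_eq_prod_eigenvalues]
    exact Real.log_prod fun i _ => (hB.eigenvalues_pos i).ne'
  rw [hlog, hB.1.trace_eq_sum_eigenvalues]
  simp

theorem trace_sub_card_sub_log_det_nonneg (hB : B.PosDef) :
    0 ≤ B.trace - Fintype.card ι - Real.log B.det := by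
  rw [trace_sub_card_sub_log_det_eq_sum hB]
  exact Finset.sum_nonneg fun i _ => sub_one_sub_log_nonneg (hB.eigenvalues_pos i)

theorem trace_sub_card_sub_log_det_eq_zero_iff (hB : B.PosDef) :
    B.trace - Fintype.card ι - Real.log B.det = 0 ↔ B = 1 := by
  refine ⟨fun h => ?_, by rintro rfl; simp⟩
  rw [trace_sub_card_sub_log_det_eq_sum hB, Finset.sum_eq_zero_iff_of_nonneg fun i _ =>
    sub_one_sub_log_nonneg (hB.eigenvalues_pos i)] at h
  have heig : RCLike.ofReal ∘ hB.1.eigenvalues = (1 : ι → ℝ) := by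
    funext i
    simpa using (sub_one_sub_log_eq_zero_iff (hB.eigenvalues_pos i)).1 (h i (Finset.mem_univ i))
  rw [hB.1.spectral_theorem, heig]
  simp

theorem abs_log_det_le_trace_add_trace_inv (hB : B.PosDef) :
    |Real.log B.det| ≤ B.trace + B⁻¹.trace := by
  have hupper := trace_sub_card_sub_log_det_nonneg hB
  have hlower := trace_sub_card_sub_log_det_nonneg hB.inv
  rw [Matrix.det_nonsing_inv, Ring.inverse_eq_inv', Real.log_inv] at hlower
  have htrace := hB.posSemidef.trace_nonneg
  have htrace_inv := hB.inv.posSemidef.trace_nonneg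
  have hcard : (0 : ℝ) ≤ Fintype.card ι := Nat.cast_nonneg _
  exact abs_le.2 ⟨by linarith only [hlower, htrace, hcard], by linarith only
    [hupper, htrace_inv, hcard]⟩

/-- Stein's loss `tr (S⁻¹ A) - log |S⁻¹ A| - p`: twice the Kullback-Leibler divergence
`KL(N(0, A) ‖ N(0, S))`. It is the excess of `-2 log f` per observation at the covariance `S` over
its minimum when the empirical covariance is `A`. -/
noncomputable def steinLoss (S A : Matrix ι ι ℝ) : ℝ :=
  (S⁻¹ * A).trace - Fintype.card ι - Real.log (S⁻¹ * A).det

/-- `S⁻¹ A` is similar to the positive definite matrix `C A Cᵀ`, where `S⁻¹ = Cᵀ C`. -/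
theorem exists_posDef_steinLoss_eq (hS : S.PosDef) (hA : A.PosDef) :
    ∃ B : Matrix ι ι ℝ, B.PosDef ∧ (B = 1 → S = A) ∧
      steinLoss S A = B.trace - Fintype.card ι - Real.log B.det := by
  obtain ⟨C, hC, hSC⟩ := exists_eq_transpose_mul_self hS.inv
  refine ⟨C * A * Cᵀ, posDef_mul_mul_transpose hA (Matrix.vecMul_injective_of_isUnit hC),
    fun hone => ?_, ?_⟩
  · have hright : A * (Cᵀ * C) = 1 := by
      rw [← Matrix.mul_assoc, _root_.mul_eq_one_comm, ← Matrix.mul_assoc, hone]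
    rw [← hSC] at hright
    rw [← Matrix.inv_eq_left_inv hright,
      Matrix.nonsing_inv_nonsing_inv S ((Matrix.isUnit_iff_isUnit_det S).1 hS.isUnit)]
  · rw [steinLoss, hSC, Matrix.mul_assoc, Matrix.trace_mul_comm, Matrix.det_mul_comm]

theorem steinLoss_nonneg (hS : S.PosDef) (hA : A.PosDef) : 0 ≤ steinLoss S A := by
  obtain ⟨B, hB, -, hloss⟩ := exists_posDef_steinLoss_eq hS hA
  exact hloss ▸ trace_sub_card_sub_log_det_nonneg hB

theorem eq_of_steinLoss_eq_zero (hS : S.PosDef) (hA : A.PosDef) (h : steinLoss S A = 0) :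
    S = A := by
  obtain ⟨B, hB, hSA, hloss⟩ := exists_posDef_steinLoss_eq hS hA
  exact hSA ((trace_sub_card_sub_log_det_eq_zero_iff hB).1 (hloss ▸ h))

end SteinLoss

section Likelihood

variable {n p : ℕ} {θ : Params p}

theorem sum_dotProduct_mulVec_eq_trace (X : Matrix (Fin n) (Fin p) ℝ)
    (M : Matrix (Fin p) (Fin p) ℝ) :
    ∑ i, X i ⬝ᵥ (M *ᵥ X i) = (M * (Xᵀ * X)).trace := by
  calc ∑ i, X i ⬝ᵥ (M *ᵥ X i) = (X * (M * Xᵀ)).trace := rfl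
    _ = (M * (Xᵀ * X)).trace := by rw [Matrix.trace_mul_comm, Matrix.mul_assoc]

theorem rowDensity_pos {S : Matrix (Fin p) (Fin p) ℝ} (hS : S.PosDef) (x : Fin p → ℝ) :
    0 < rowDensity S x := by
  have := hS.det_pos
  unfold rowDensity
  positivity

theorem neg_two_mul_log_rowDensity {S : Matrix (Fin p) (Fin p) ℝ} (hS : S.PosDef)
    (x : Fin p → ℝ) :
    -2 * Real.log (rowDensity S x) =
      p * Real.log (2 * Real.pi) + Real.log S.det + x ⬝ᵥ (S⁻¹ *ᵥ x) := by
  have hdet := hS.det_pos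
  rw [rowDensity, Real.log_mul (by positivity) (by positivity), Real.log_exp, Real.log_inv,
    Real.log_sqrt (by positivity), Real.log_mul (by positivity) hdet.ne', Real.log_pow]
  ring

theorem neg_two_mul_log_gaussianPDFReal (μ y : ℝ) {v : ℝ} (hv : 0 < v) :
    -2 * Real.log (gaussianPDFReal μ v.toNNReal y) =
      Real.log (2 * Real.pi * v) + (y - μ) ^ 2 / v := by
  rw [gaussianPDFReal, Real.coe_toNNReal _ hv.le, Real.log_mul (by positivity) (by positivity),
    Real.log_exp, Real.log_inv, Real.log_sqrt (by positivity)]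
  field_simp
  ring

theorem obsDensity_pos (hvar : 0 < θ.var) (hcov : θ.cov.PosDef) (y : ℝ) (x : Fin p → ℝ) :
    0 < obsDensity θ y x :=
  mul_pos (gaussianPDFReal_pos _ _ _ (by simpa using hvar)) (rowDensity_pos hcov x)

theorem neg_two_mul_log_obsDensity (hvar : 0 < θ.var) (hcov : θ.cov.PosDef) (y : ℝ)
    (x : Fin p → ℝ) :
    -2 * Real.log (obsDensity θ y x) =
      Real.log (2 * Real.pi * θ.var) + (y - x ⬝ᵥ θ.β) ^ 2 / θ.var
        + (p * Real.log (2 * Real.pi) + Real.log θ.cov.det + x ⬝ᵥ (θ.cov⁻¹ *ᵥ x)) := by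
  have hpdf := gaussianPDFReal_pos (x ⬝ᵥ θ.β) θ.var.toNNReal y (by simpa using hvar)
  rw [obsDensity, Real.log_mul hpdf.ne' (rowDensity_pos hcov x).ne', mul_add,
    neg_two_mul_log_gaussianPDFReal _ _ hvar, neg_two_mul_log_rowDensity hcov]

theorem negTwoLogLik_eq (X : Matrix (Fin n) (Fin p) ℝ) (y : Fin n → ℝ) (hvar : 0 < θ.var)
    (hcov : θ.cov.PosDef) :
    negTwoLogLik X y θ = n * Real.log (2 * Real.pi * θ.var)
      + (∑ i, (y i - (X *ᵥ θ.β) i) ^ 2) / θ.var + n * p * Real.log (2 * Real.pi)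
      + n * Real.log θ.cov.det + (θ.cov⁻¹ * (Xᵀ * X)).trace := by
  rw [negTwoLogLik, Real.log_prod fun i _ => (obsDensity_pos hvar hcov (y i) (X i)).ne',
    Finset.mul_sum,
    Finset.sum_congr rfl fun i _ => neg_two_mul_log_obsDensity hvar hcov (y i) (X i)]
  simp only [Finset.sum_add_distrib, Finset.sum_const, Finset.card_univ, Fintype.card_fin,
    nsmul_eq_mul, ← Finset.sum_div, sum_dotProduct_mulVec_eq_trace]
  simp only [Matrix.mulVec]
  ring

end Likelihood

section LeastSquares

variable {n q : ℕ} {U : Matrix (Fin n) (Fin q) ℝ}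

theorem posDef_transpose_mul_self_iff :
    (Uᵀ * U).PosDef ↔ Function.Injective U.mulVec := by
  refine ⟨fun h v w hvw => Matrix.mulVec_injective_of_isUnit h.isUnit ?_, fun h => ?_⟩
  · simp only [← Matrix.mulVec_mulVec]
    exact congrArg _ hvw
  · simpa only [Matrix.conjTranspose_eq_transpose_of_trivial] using
      Matrix.PosDef.conjTranspose_mul_self U h

theorem transpose_mul_self_isUnit_det (hU : (Uᵀ * U).PosDef) : IsUnit (Uᵀ * U).det :=
  (Matrix.isUnit_iff_isUnit_det _).1 hU.isUnit

theorem dotProduct_transpose_mul_self_mulVec (U : Matrix (Fin n) (Fin q) ℝ) (d : Fin q → ℝ) :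
    d ⬝ᵥ ((Uᵀ * U) *ᵥ d) = (U *ᵥ d) ⬝ᵥ (U *ᵥ d) := by
  rw [← Matrix.mulVec_mulVec, Matrix.dotProduct_mulVec, Matrix.vecMul_transpose]

theorem sum_sq_sub_mulVec_of_orthogonal {z : Fin n → ℝ} {d : Fin q → ℝ}
    (h : z ⬝ᵥ (U *ᵥ d) = 0) :
    ∑ i, (z i - (U *ᵥ d) i) ^ 2 = ∑ i, z i ^ 2 + d ⬝ᵥ ((Uᵀ * U) *ᵥ d) := by
  have hcross : ∑ i, z i * (U *ᵥ d) i = 0 := h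
  calc ∑ i, (z i - (U *ᵥ d) i) ^ 2
      = ∑ i, z i ^ 2 - 2 * ∑ i, z i * (U *ᵥ d) i + (U *ᵥ d) ⬝ᵥ (U *ᵥ d) := by
        simp only [dotProduct, Finset.mul_sum, ← Finset.sum_sub_distrib, ← Finset.sum_add_distrib]
        exact Finset.sum_congr rfl fun i _ => by ring
    _ = _ := by rw [hcross, dotProduct_transpose_mul_self_mulVec]; ring

theorem transpose_mulVec_residual (hU : (Uᵀ * U).PosDef) (e : Fin n → ℝ) :
    Uᵀ *ᵥ (e - U *ᵥ betaFull U e) = 0 := by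
  rw [Matrix.mulVec_sub, Matrix.mulVec_mulVec, betaFull, Matrix.mulVec_mulVec,
    Matrix.mul_nonsing_inv _ (transpose_mul_self_isUnit_det hU), Matrix.one_mulVec, sub_self]

theorem residual_dotProduct_mulVec (hU : (Uᵀ * U).PosDef) (e : Fin n → ℝ) (c : Fin q → ℝ) :
    (e - U *ᵥ betaFull U e) ⬝ᵥ (U *ᵥ c) = 0 := by
  rw [Matrix.dotProduct_mulVec, ← Matrix.mulVec_transpose, transpose_mulVec_residual hU,
    zero_dotProduct]

theorem eq_betaFull_of_normal_equations (hU : (Uᵀ * U).PosDef) {e : Fin n → ℝ} {c : Fin q → ℝ}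
    (h : Uᵀ *ᵥ (e - U *ᵥ c) = 0) : c = betaFull U e := by
  rw [Matrix.mulVec_sub, Matrix.mulVec_mulVec, sub_eq_zero] at h
  rw [betaFull, h, Matrix.mulVec_mulVec,
    Matrix.nonsing_inv_mul _ (transpose_mul_self_isUnit_det hU), Matrix.one_mulVec]

/-- The residual sum of squares of the least squares regression of `e` on the columns of `U`. -/
noncomputable def olsRss (U : Matrix (Fin n) (Fin q) ℝ) (e : Fin n → ℝ) : ℝ :=
  ∑ i, (e i - (U *ᵥ betaFull U e) i) ^ 2

theorem olsRss_nonneg (U : Matrix (Fin n) (Fin q) ℝ) (e : Fin n → ℝ) : 0 ≤ olsRss U e :=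
  Finset.sum_nonneg fun _ _ => sq_nonneg _

theorem olsRss_le_sum_sq (hU : (Uᵀ * U).PosDef) (e : Fin n → ℝ) :
    olsRss U e ≤ ∑ i, e i ^ 2 := by
  have hpyth := sum_sq_sub_mulVec_of_orthogonal
    (residual_dotProduct_mulVec hU e (-betaFull U e))
  have hquad := hU.posSemidef.dotProduct_mulVec_nonneg (-betaFull U e)
  simp only [Matrix.mulVec_neg, Pi.neg_apply, Pi.sub_apply, sub_neg_eq_add,
    sub_add_cancel] at hpyth
  rw [hpyth]
  exact le_add_of_nonneg_right (by simpa [Matrix.mulVec_neg] using hquad)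

theorem dotProduct_residual (hU : (Uᵀ * U).PosDef) (e : Fin n → ℝ) :
    e ⬝ᵥ (e - U *ᵥ betaFull U e) = olsRss U e := by
  rw [dotProduct_comm, ← sub_zero (_ ⬝ᵥ e), ← residual_dotProduct_mulVec hU e (betaFull U e),
    ← dotProduct_sub, olsRss]
  simp only [dotProduct, sq, Pi.sub_apply]

theorem olsRss_mulVec_self (hU : (Uᵀ * U).PosDef) (c : Fin q → ℝ) :
    olsRss U (U *ᵥ c) = 0 := by
  have hfit : c = betaFull U (U *ᵥ c) := eq_betaFull_of_normal_equations hU (by simp)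
  simp [olsRss, ← hfit]

theorem betaFull_smul (U : Matrix (Fin n) (Fin q) ℝ) (a : ℝ) (e : Fin n → ℝ) :
    betaFull U (a • e) = a • betaFull U e := by
  simp only [betaFull, Matrix.mulVec_smul]

theorem olsRss_smul (U : Matrix (Fin n) (Fin q) ℝ) (a : ℝ) (e : Fin n → ℝ) :
    olsRss U (a • e) = a ^ 2 * olsRss U e := by
  simp only [olsRss, betaFull_smul, Matrix.mulVec_smul, Pi.smul_apply, smul_eq_mul, Finset.mul_sum]
  exact Finset.sum_congr rfl fun i _ => by ring

end LeastSquares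

section RestrictedLeastSquares

variable {n p m : ℕ} {X : Matrix (Fin n) (Fin p) ℝ} {R : Matrix (Fin m) (Fin p) ℝ}

theorem posDef_mul_inv_mul_transpose {A : Matrix (Fin p) (Fin p) ℝ} (hA : A.PosDef)
    (hR : R.rank = m) : (R * A⁻¹ * Rᵀ).PosDef := by
  refine posDef_mul_mul_transpose hA.inv (Matrix.vecMul_injective_iff.2 ?_)
  rw [linearIndependent_iff_card_eq_finrank_span, Fintype.card_fin, Set.finrank,
    ← Matrix.rank_eq_finrank_span_row, hR]

theorem mulVec_betaHat (hX : (Xᵀ * X).PosDef) (hR : R.rank = m) (r : Fin m → ℝ)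
    (y : Fin n → ℝ) : R *ᵥ betaHat R r X y = r := by
  have hdet := (Matrix.isUnit_iff_isUnit_det _).1 (posDef_mul_inv_mul_transpose hX hR).isUnit
  rw [betaHat, Matrix.mulVec_add, Matrix.mulVec_mulVec, ← Matrix.mul_assoc, ← Matrix.mul_assoc,
    Matrix.mul_nonsing_inv _ hdet, Matrix.one_mulVec, add_sub_cancel]

/-- Lagrange's condition for the minimization of `‖y - X β‖²` subject to `R β = r`. -/
theorem transpose_mulVec_restricted_residual (hX : (Xᵀ * X).PosDef) (r : Fin m → ℝ)
    (y : Fin n → ℝ) : ∃ μ : Fin m → ℝ, Xᵀ *ᵥ (y - X *ᵥ betaHat R r X y) = Rᵀ *ᵥ μ := by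
  refine ⟨-((R * (Xᵀ * X)⁻¹ * Rᵀ)⁻¹ *ᵥ (r - R *ᵥ betaFull X y)), ?_⟩
  rw [betaHat, Matrix.mulVec_add, ← sub_sub, Matrix.mulVec_sub, transpose_mulVec_residual hX,
    zero_sub, Matrix.mulVec_neg, Matrix.mulVec_mulVec, Matrix.mulVec_mulVec, Matrix.mul_assoc,
    ← Matrix.mul_assoc Xᵀ, ← Matrix.mul_assoc (Xᵀ * X), ← Matrix.mul_assoc (Xᵀ * X),
    Matrix.mul_nonsing_inv _ (transpose_mul_self_isUnit_det hX), Matrix.one_mul,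
    Matrix.mulVec_mulVec]

theorem sum_sq_sub_mulVec_eq_rss_add (hX : (Xᵀ * X).PosDef) (hR : R.rank = m) {r : Fin m → ℝ}
    (y : Fin n → ℝ) {β : Fin p → ℝ} (hβ : R *ᵥ β = r) :
    ∑ i, (y i - (X *ᵥ β) i) ^ 2 = rss R r X y +
      (β - betaHat R r X y) ⬝ᵥ ((Xᵀ * X) *ᵥ (β - betaHat R r X y)) := by
  obtain ⟨μ, hμ⟩ := transpose_mulVec_restricted_residual (R := R) hX r y
  have hker : R *ᵥ (β - betaHat R r X y) = 0 := by
    rw [Matrix.mulVec_sub, mulVec_betaHat hX hR, hβ, sub_self]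
  have horth : (y - X *ᵥ betaHat R r X y) ⬝ᵥ (X *ᵥ (β - betaHat R r X y)) = 0 := by
    rw [Matrix.dotProduct_mulVec, ← Matrix.mulVec_transpose, hμ, Matrix.mulVec_transpose,
      ← Matrix.dotProduct_mulVec, hker, dotProduct_zero]
  rw [rss]
  simpa only [Matrix.mulVec_sub, Pi.sub_apply, sub_sub_sub_cancel_right] using
    sum_sq_sub_mulVec_of_orthogonal horth

end RestrictedLeastSquares

section MaximumLikelihood

variable {n p m : ℕ} {X : Matrix (Fin n) (Fin p) ℝ} {R : Matrix (Fin m) (Fin p) ℝ}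
  {r : Fin m → ℝ} {y : Fin n → ℝ} {θ : Params p}

theorem mle_mem_restrictedParams (hX : (Xᵀ * X).PosDef) (hR : R.rank = m) (hn : 0 < n)
    (hrss : 0 < rss R r X y) : mle R r X y ∈ restrictedParams R r := by
  have hn' : (0 : ℝ) < n := Nat.cast_pos.2 hn
  exact ⟨mulVec_betaHat hX hR r y, div_pos hrss hn', hX.smul (inv_pos.2 hn')⟩

theorem trainErr_eq (hX : (Xᵀ * X).PosDef) (hR : R.rank = m) (hn : 0 < n)
    (hrss : 0 < rss R r X y) :
    trainErr R r X y = n * Real.log (rss R r X y / n)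
      + n * Real.log ((n : ℝ)⁻¹ • (Xᵀ * X)).det
      + n * (p + 1) * (Real.log (2 * Real.pi) + 1) := by
  obtain ⟨-, hvar, hcov⟩ := mle_mem_restrictedParams hX hR hn hrss
  have hn' : (n : ℝ) ≠ 0 := (Nat.cast_pos.2 hn).ne'
  have htrace : ((mle R r X y).cov⁻¹ * (Xᵀ * X)).trace = n * p := by
    have hgram : Xᵀ * X = (n : ℝ) • (mle R r X y).cov := by
      simp only [mle, smul_smul, mul_inv_cancel₀ hn', one_smul]
    rw [hgram, Matrix.mul_smul, Matrix.nonsing_inv_mul _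
      ((Matrix.isUnit_iff_isUnit_det _).1 hcov.isUnit)]
    simp
  have hfit : (∑ i, (y i - (X *ᵥ (mle R r X y).β) i) ^ 2) / (mle R r X y).var = n :=
    div_div_cancel₀ hrss.ne'
  rw [trainErr, negTwoLogLik_eq X y hvar hcov, htrace, hfit,
    Real.log_mul (by positivity) hvar.ne']
  simp only [mle]
  ring

theorem trainErr_add_eq_raicc_add_restrictionFree (hX : (Xᵀ * X).PosDef) (hR : R.rank = m)
    (hn : 0 < n) (hrss : 0 < rss R r X y) :
    trainErr R r X y + (n * ((n * (n - 1)) / (((n : ℝ) - p + m - 2) * ((n : ℝ) - p + m - 1)))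
      + n * ((n * p) / ((n : ℝ) - p - 1)) - n * (p + 1)) = raicc R r X y + restrictionFree X := by
  rw [trainErr_eq hX hR hn hrss, raicc, restrictionFree]
  ring

/-- Relative to the fit `mle`, the likelihood at `θ` loses one nonnegative term for each of the
variance, the covariance and the regression vector. -/
theorem negTwoLogLik_eq_trainErr_add (hX : (Xᵀ * X).PosDef) (hR : R.rank = m) (hn : 0 < n)
    (hrss : 0 < rss R r X y) (hθ : θ ∈ restrictedParams R r) :
    negTwoLogLik X y θ = trainErr R r X y
      + n * (rss R r X y / n / θ.var - 1 - Real.log (rss R r X y / n / θ.var))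
      + n * steinLoss θ.cov ((n : ℝ)⁻¹ • (Xᵀ * X))
      + (θ.β - betaHat R r X y) ⬝ᵥ ((Xᵀ * X) *ᵥ (θ.β - betaHat R r X y)) / θ.var := by
  obtain ⟨hβ, hvar, hcov⟩ := hθ
  have hn' : (0 : ℝ) < n := Nat.cast_pos.2 hn
  have hgram : ((n : ℝ)⁻¹ • (Xᵀ * X)).PosDef := hX.smul (inv_pos.2 hn')
  have htrace : (θ.cov⁻¹ * ((n : ℝ)⁻¹ • (Xᵀ * X))).trace
      = (n : ℝ)⁻¹ * (θ.cov⁻¹ * (Xᵀ * X)).trace := by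
    rw [Matrix.mul_smul, Matrix.trace_smul, smul_eq_mul]
  have hdet : Real.log (θ.cov⁻¹ * ((n : ℝ)⁻¹ • (Xᵀ * X))).det
      = Real.log ((n : ℝ)⁻¹ • (Xᵀ * X)).det - Real.log θ.cov.det := by
    rw [Matrix.det_mul, Matrix.det_nonsing_inv, Ring.inverse_eq_inv',
      Real.log_mul (inv_ne_zero hcov.det_pos.ne') hgram.det_pos.ne', Real.log_inv]
    ring
  rw [negTwoLogLik_eq X y hvar hcov, sum_sq_sub_mulVec_eq_rss_add hX hR y hβ,
    trainErr_eq hX hR hn hrss, steinLoss, htrace, hdet, Fintype.card_fin,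
    Real.log_mul (by positivity) hvar.ne', Real.log_div (div_pos hrss hn').ne' hvar.ne']
  field_simp
  ring

theorem negTwoLogLik_excess_nonneg (hX : (Xᵀ * X).PosDef) (hR : R.rank = m) (hn : 0 < n)
    (hrss : 0 < rss R r X y) (hθ : θ ∈ restrictedParams R r) :
    0 ≤ n * (rss R r X y / n / θ.var - 1 - Real.log (rss R r X y / n / θ.var)) ∧
      0 ≤ n * steinLoss θ.cov ((n : ℝ)⁻¹ • (Xᵀ * X)) ∧
      0 ≤ (θ.β - betaHat R r X y) ⬝ᵥ ((Xᵀ * X) *ᵥ (θ.β - betaHat R r X y)) / θ.var := by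
  obtain ⟨-, hvar, hcov⟩ := mle_mem_restrictedParams hX hR hn hrss
  refine ⟨mul_nonneg n.cast_nonneg (sub_one_sub_log_nonneg (div_pos hvar hθ.2.1)),
    mul_nonneg n.cast_nonneg (steinLoss_nonneg hθ.2.2 hcov), div_nonneg ?_ hθ.2.1.le⟩
  simpa only [star_trivial] using
    hX.posSemidef.dotProduct_mulVec_nonneg (θ.β - betaHat R r X y)

theorem trainErr_le_negTwoLogLik (hX : (Xᵀ * X).PosDef) (hR : R.rank = m) (hn : 0 < n)
    (hrss : 0 < rss R r X y) (hθ : θ ∈ restrictedParams R r) :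
    trainErr R r X y ≤ negTwoLogLik X y θ := by
  obtain ⟨hvar, hcov, hβ⟩ := negTwoLogLik_excess_nonneg hX hR hn hrss hθ
  rw [negTwoLogLik_eq_trainErr_add hX hR hn hrss hθ]
  linarith only [hvar, hcov, hβ]

theorem eq_mle_of_negTwoLogLik_le (hX : (Xᵀ * X).PosDef) (hR : R.rank = m) (hn : 0 < n)
    (hrss : 0 < rss R r X y) (hθ : θ ∈ restrictedParams R r)
    (hle : negTwoLogLik X y θ ≤ trainErr R r X y) : θ = mle R r X y := by
  have hn' : (n : ℝ) ≠ 0 := (Nat.cast_pos.2 hn).ne'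
  have hmle := mle_mem_restrictedParams hX hR hn hrss
  obtain ⟨hvar, hcov, hβ⟩ := negTwoLogLik_excess_nonneg hX hR hn hrss hθ
  rw [negTwoLogLik_eq_trainErr_add hX hR hn hrss hθ] at hle
  refine Params.ext ?_ ?_ ?_
  · by_contra hne
    have hpos := div_pos (hX.dotProduct_mulVec_pos (sub_ne_zero.2 hne)) hθ.2.1
    simp only [star_trivial, mle] at hpos
    linarith only [hvar, hcov, hpos, hle]
  · have hzero := le_antisymm (by linarith only [hcov, hβ, hle]) hvar
    have hratio := (sub_one_sub_log_eq_zero_iff (div_pos hmle.2.1 hθ.2.1)).1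
      ((mul_eq_zero.1 hzero).resolve_left hn')
    exact ((div_eq_one_iff_eq hθ.2.1.ne').1 hratio).symm
  · have hzero := le_antisymm (by linarith only [hvar, hβ, hle]) hcov
    exact eq_of_steinLoss_eq_zero hθ.2.2 hmle.2.2 ((mul_eq_zero.1 hzero).resolve_left hn')

theorem isRestrictedMLE_iff (hX : (Xᵀ * X).PosDef) (hR : R.rank = m) (hn : 0 < n)
    (hrss : 0 < rss R r X y) : IsRestrictedMLE R r X y θ ↔ θ = mle R r X y := by
  have hmle := mle_mem_restrictedParams hX hR hn hrss
  constructor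
  · rintro ⟨hmem, hmin⟩
    exact eq_mle_of_negTwoLogLik_le hX hR hn hrss hmem (hmin hmle)
  · rintro rfl
    exact ⟨hmle, fun θ hθ => trainErr_le_negTwoLogLik hX hR hn hrss hθ⟩

end MaximumLikelihood

section OrthonormalKerBasis

variable {n p q m : ℕ} {S : Matrix (Fin p) (Fin p) ℝ}

theorem exists_transpose_mul_mul_eq_one (hS : S.PosDef) :
    ∃ L : Matrix (Fin p) (Fin p) ℝ, Lᵀ * S * L = 1 := by
  obtain ⟨B, hB, rfl⟩ := exists_eq_transpose_mul_self hS
  have hinv : B * B⁻¹ = 1 := Matrix.mul_nonsing_inv _ ((Matrix.isUnit_iff_isUnit_det B).1 hB)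
  refine ⟨B⁻¹, ?_⟩
  rw [← Matrix.mul_assoc, ← Matrix.transpose_mul, hinv, Matrix.transpose_one, Matrix.one_mul, hinv]

/-- The columns of `N` are a basis of the kernel of `R`, orthonormal for the inner product
`(u, v) ↦ uᵀ S v`. They parametrize the restricted model as `β₀ + N c`, with `c` free. -/
structure IsOrthonormalKerBasis (S : Matrix (Fin p) (Fin p) ℝ) (R : Matrix (Fin m) (Fin p) ℝ)
    (N : Matrix (Fin p) (Fin q) ℝ) : Prop where
  mul_eq_zero : R * N = 0
  orthonormal : Nᵀ * S * N = 1
  exists_eq_mulVec : ∀ v, R *ᵥ v = 0 → ∃ c, v = N *ᵥ c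

theorem exists_injective_mulVec_ker (R : Matrix (Fin m) (Fin p) ℝ) (hR : q + R.rank = p) :
    ∃ K : Matrix (Fin p) (Fin q) ℝ, Function.Injective K.mulVec ∧ R * K = 0 ∧
      ∀ v, R *ᵥ v = 0 → ∃ c, v = K *ᵥ c := by
  have hdim : Module.finrank ℝ (LinearMap.ker R.mulVecLin) = q := by
    have hrank : R.rank + _ = _ := LinearMap.finrank_range_add_finrank_ker R.mulVecLin
    rw [Module.finrank_fin_fun] at hrank
    lia
  let coords := (Module.finBasisOfFinrankEq ℝ _ hdim).equivFun
  let f : (Fin q → ℝ) →ₗ[ℝ] Fin p → ℝ := (Submodule.subtype _) ∘ₗ coords.symm.toLinearMap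
  have hmulVec (c : Fin q → ℝ) : f.toMatrix' *ᵥ c = coords.symm c := LinearMap.toMatrix'_mulVec f c
  refine ⟨f.toMatrix', fun c d hcd => ?_, ?_, fun v hv => ⟨coords ⟨v, hv⟩, ?_⟩⟩
  · exact coords.symm.injective (Subtype.ext (by simpa only [hmulVec] using hcd))
  · refine Matrix.ext_of_mulVec_single fun j => ?_
    rw [← Matrix.mulVec_mulVec, hmulVec, Matrix.zero_mulVec]
    exact (coords.symm _).2
  · rw [hmulVec, LinearEquiv.symm_apply_apply]

theorem exists_isOrthonormalKerBasis (hS : S.PosDef) (R : Matrix (Fin m) (Fin p) ℝ)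
    (hR : q + R.rank = p) : ∃ N : Matrix (Fin p) (Fin q) ℝ, IsOrthonormalKerBasis S R N := by
  obtain ⟨K, hinj, hRK, hsurj⟩ := exists_injective_mulVec_ker R hR
  have hgram : (Kᵀ * S * K).PosDef := by
    simpa only [Matrix.conjTranspose_eq_transpose_of_trivial] using
      hS.conjTranspose_mul_mul_same hinj
  obtain ⟨L, hL⟩ := exists_transpose_mul_mul_eq_one hgram
  refine ⟨K * L, ?_, ?_, fun v hv => ?_⟩
  · rw [← Matrix.mul_assoc, hRK, Matrix.zero_mul]
  · rw [← hL, Matrix.transpose_mul]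
    simp only [Matrix.mul_assoc]
  · obtain ⟨c, rfl⟩ := hsurj v hv
    refine ⟨(Lᵀ * (Kᵀ * S * K)) *ᵥ c, ?_⟩
    rw [Matrix.mulVec_mulVec, Matrix.mul_assoc K, _root_.mul_eq_one_comm.1 hL, Matrix.mul_one]

theorem posDef_gram_mul {X : Matrix (Fin n) (Fin p) ℝ} {N : Matrix (Fin p) (Fin q) ℝ}
    (hX : (Xᵀ * X).PosDef) (hN : Nᵀ * S * N = 1) : ((X * N)ᵀ * (X * N)).PosDef := by
  rw [posDef_transpose_mul_self_iff] at hX ⊢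
  intro c d hcd
  simp only [← Matrix.mulVec_mulVec] at hcd
  have hNS := congrArg ((Nᵀ * S) *ᵥ ·) (hX hcd)
  simpa [Matrix.mulVec_mulVec, hN] using hNS

theorem dotProduct_mulVec_mulVec_eq_sum_sq {N : Matrix (Fin p) (Fin q) ℝ} (hN : Nᵀ * S * N = 1)
    (b : Fin q → ℝ) : (N *ᵥ b) ⬝ᵥ (S *ᵥ (N *ᵥ b)) = ∑ j, b j ^ 2 := by
  rw [Matrix.mulVec_mulVec, ← Matrix.vecMul_transpose, ← Matrix.dotProduct_mulVec,
    Matrix.mulVec_mulVec, ← Matrix.mul_assoc, hN, Matrix.one_mulVec]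
  simp only [dotProduct, sq]

section Transformation

variable {X : Matrix (Fin n) (Fin p) ℝ} {N : Matrix (Fin p) (Fin p) ℝ}

theorem gram_mul (X : Matrix (Fin n) (Fin p) ℝ) (N : Matrix (Fin p) (Fin q) ℝ) :
    (X * N)ᵀ * (X * N) = Nᵀ * (Xᵀ * X) * N := by
  rw [Matrix.transpose_mul]
  simp only [Matrix.mul_assoc]

theorem det_gram_mul : ((X * N)ᵀ * (X * N)).det = N.det ^ 2 * (Xᵀ * X).det := by
  rw [gram_mul, Matrix.det_mul, Matrix.det_mul, Matrix.det_transpose]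
  ring

theorem posDef_gram_of_posDef_gram_mul (h : ((X * N)ᵀ * (X * N)).PosDef) : (Xᵀ * X).PosDef := by
  have hdet := h.det_pos.ne'
  rw [det_gram_mul] at hdet
  rw [← Matrix.conjTranspose_eq_transpose_of_trivial] at hdet ⊢
  exact (Matrix.posSemidef_conjTranspose_mul_self X).posDef_iff_det_ne_zero.2
    (right_ne_zero_of_mul hdet)

theorem trace_inv_gram_mul (hN : Nᵀ * S * N = 1) :
    ((X * N)ᵀ * (X * N))⁻¹.trace = ((Xᵀ * X)⁻¹ * S).trace := by
  have hinv : S * N * Nᵀ = 1 := _root_.mul_eq_one_comm.1 ((Matrix.mul_assoc ..).symm.trans hN)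
  have hS : (Nᵀ)⁻¹ * N⁻¹ = S := by
    rw [← Matrix.mul_inv_rev]
    exact Matrix.inv_eq_left_inv (by rw [← Matrix.mul_assoc, hinv])
  rw [gram_mul, Matrix.mul_inv_rev, Matrix.mul_inv_rev, Matrix.trace_mul_comm, Matrix.mul_assoc, hS]

end Transformation

section RestrictedFit

variable {X : Matrix (Fin n) (Fin p) ℝ} {R : Matrix (Fin m) (Fin p) ℝ}
  {N : Matrix (Fin p) (Fin q) ℝ}

theorem IsOrthonormalKerBasis.betaHat_eq (hN : IsOrthonormalKerBasis S R N)
    (hX : (Xᵀ * X).PosDef) (hR : R.rank = m) (β₀ : Fin p → ℝ) (e : Fin n → ℝ) :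
    betaHat R (R *ᵥ β₀) X (X *ᵥ β₀ + e) = β₀ + N *ᵥ betaFull (X * N) e := by
  set b := betaHat R (R *ᵥ β₀) X (X *ᵥ β₀ + e)
  obtain ⟨c, hc⟩ := hN.exists_eq_mulVec (b - β₀) (by
    rw [Matrix.mulVec_sub, mulVec_betaHat hX hR, sub_self])
  rw [sub_eq_iff_eq_add'] at hc
  obtain ⟨μ, hμ⟩ :=
    transpose_mulVec_restricted_residual (R := R) hX (R *ᵥ β₀) (X *ᵥ β₀ + e)
  have hresidual : X *ᵥ β₀ + e - X *ᵥ b = e - (X * N) *ᵥ c := by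
    rw [hc, Matrix.mulVec_add, Matrix.mulVec_mulVec, add_sub_add_left_eq_sub]
  have hnormal : (X * N)ᵀ *ᵥ (e - (X * N) *ᵥ c) = 0 := by
    rw [← hresidual, Matrix.transpose_mul, ← Matrix.mulVec_mulVec, hμ, Matrix.mulVec_mulVec,
      ← Matrix.transpose_mul, hN.mul_eq_zero, Matrix.transpose_zero, Matrix.zero_mulVec]
  rw [hc, eq_betaFull_of_normal_equations (posDef_gram_mul hX hN.orthonormal) hnormal]

theorem IsOrthonormalKerBasis.rss_eq (hN : IsOrthonormalKerBasis S R N)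
    (hX : (Xᵀ * X).PosDef) (hR : R.rank = m) (β₀ : Fin p → ℝ) (e : Fin n → ℝ) :
    rss R (R *ᵥ β₀) X (X *ᵥ β₀ + e) = olsRss (X * N) e := by
  rw [rss, hN.betaHat_eq hX hR, olsRss]
  simp only [Matrix.mulVec_add, Matrix.mulVec_mulVec, Pi.add_apply, add_sub_add_left_eq_sub]

end RestrictedFit

end OrthonormalKerBasis

section OrthonormalCoordinates

variable {n q k : ℕ} {U : Matrix (Fin n) (Fin q) ℝ} {L : Matrix (Fin q) (Fin q) ℝ}
  {M : Matrix (Fin n) (Fin k) ℝ}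

theorem inv_gram_eq_mul_transpose (hL : Lᵀ * (Uᵀ * U) * L = 1) : (Uᵀ * U)⁻¹ = L * Lᵀ := by
  refine Matrix.inv_eq_left_inv ?_
  rw [Matrix.mul_assoc, _root_.mul_eq_one_comm.1 hL]

theorem exists_orthonormal_coordinates (hU : (Uᵀ * U).PosDef) (hk : k + q = n) :
    ∃ (L : Matrix (Fin q) (Fin q) ℝ) (M : Matrix (Fin n) (Fin k) ℝ),
      Lᵀ * (Uᵀ * U) * L = 1 ∧ IsOrthonormalKerBasis 1 Uᵀ M := by
  have hrank : (Uᵀ).rank = q := by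
    rw [Matrix.rank_transpose, ← Matrix.rank_transpose_mul_self, Matrix.rank_of_isUnit _ hU.isUnit,
      Fintype.card_fin]
  obtain ⟨L, hL⟩ := exists_transpose_mul_mul_eq_one hU
  obtain ⟨M, hM⟩ := exists_isOrthonormalKerBasis (q := k) Matrix.PosDef.one Uᵀ (by rwa [hrank])
  exact ⟨L, M, hL, hM⟩

theorem mul_transpose_add_mul_transpose_eq_one (hL : Lᵀ * (Uᵀ * U) * L = 1)
    (hM : IsOrthonormalKerBasis 1 Uᵀ M) : (U * L) * (U * L)ᵀ + M * Mᵀ = 1 := by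
  have hMU : Mᵀ * U = 0 := by
    rw [← Matrix.transpose_transpose U, ← Matrix.transpose_mul, hM.mul_eq_zero,
      Matrix.transpose_zero]
  have hproj : Uᵀ * ((U * L) * (U * L)ᵀ) = Uᵀ := by
    rw [Matrix.transpose_mul]
    calc Uᵀ * ((U * L) * (Lᵀ * Uᵀ)) = ((Uᵀ * U * L) * Lᵀ) * Uᵀ := by simp only [Matrix.mul_assoc]
      _ = Uᵀ := by
        rw [_root_.mul_eq_one_comm.1 ((Matrix.mul_assoc _ _ _).symm.trans hL), Matrix.one_mul]
  refine Matrix.ext_of_mulVec_single fun i => ?_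
  generalize (Pi.single i 1 : Fin n → ℝ) = v
  obtain ⟨c, hc⟩ := hM.exists_eq_mulVec (v - ((U * L) * (U * L)ᵀ) *ᵥ v) (by
    rw [Matrix.mulVec_sub, Matrix.mulVec_mulVec, hproj, sub_self])
  have hcoord : Mᵀ *ᵥ v = c := by
    have h := congrArg (Mᵀ *ᵥ ·) hc
    simpa [Matrix.mulVec_sub, Matrix.mulVec_mulVec, ← Matrix.mul_assoc, hMU,
      (by simpa using hM.orthonormal : Mᵀ * M = 1)] using h
  rw [Matrix.add_mulVec, ← Matrix.mulVec_mulVec _ M, hcoord, ← hc, add_sub_cancel,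
    Matrix.one_mulVec]

theorem betaFull_coordinates (hL : Lᵀ * (Uᵀ * U) * L = 1) (hM : Uᵀ * M = 0)
    (a : Fin q → ℝ) (c : Fin k → ℝ) :
    betaFull U ((U * L) *ᵥ a + M *ᵥ c) = L *ᵥ a := by
  rw [betaFull, inv_gram_eq_mul_transpose hL, Matrix.mulVec_add, Matrix.mulVec_mulVec _ Uᵀ M, hM,
    Matrix.zero_mulVec, add_zero, Matrix.mulVec_mulVec, Matrix.mulVec_mulVec]
  calc (L * Lᵀ * Uᵀ * (U * L)) *ᵥ a = (L * (Lᵀ * (Uᵀ * U) * L)) *ᵥ a := by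
        simp only [Matrix.mul_assoc]
    _ = L *ᵥ a := by rw [hL, Matrix.mul_one]

theorem olsRss_coordinates (hL : Lᵀ * (Uᵀ * U) * L = 1) (hM : IsOrthonormalKerBasis 1 Uᵀ M)
    (a : Fin q → ℝ) (c : Fin k → ℝ) :
    olsRss U ((U * L) *ᵥ a + M *ᵥ c) = ∑ i, c i ^ 2 := by
  rw [← dotProduct_mulVec_mulVec_eq_sum_sq hM.orthonormal, olsRss,
    betaFull_coordinates hL hM.mul_eq_zero]
  simp only [Matrix.mulVec_mulVec, Pi.add_apply, add_sub_cancel_left, Matrix.one_mul, dotProduct,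
    sq]

end OrthonormalCoordinates

section GramColumn

variable {n q : ℕ} {U : Matrix (Fin n) (Fin (q + 1)) ℝ} {j : Fin (q + 1)}

theorem mulVec_eq_col_add_submatrix_mulVec (U : Matrix (Fin n) (Fin (q + 1)) ℝ)
    (j : Fin (q + 1)) (v : Fin (q + 1) → ℝ) :
    U *ᵥ v = v j • U.col j + U.submatrix id j.succAbove *ᵥ j.removeNth v := by
  ext i
  simp only [Matrix.mulVec, dotProduct, Pi.add_apply, Pi.smul_apply, smul_eq_mul,
    Fin.sum_univ_succAbove _ j, mul_comm (U i j)]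
  rfl

theorem posDef_gram_of_olsRss_col_pos
    (hV : ((U.submatrix id j.succAbove)ᵀ * U.submatrix id j.succAbove).PosDef)
    (hpos : 0 < olsRss (U.submatrix id j.succAbove) (U.col j)) : (Uᵀ * U).PosDef := by
  rw [posDef_transpose_mul_self_iff]
  refine (injective_iff_map_eq_zero U.mulVecLin).2 fun v hv => ?_
  rw [Matrix.mulVecLin_apply, mulVec_eq_col_add_submatrix_mulVec U j] at hv
  have hvj : v j = 0 := by
    by_contra hne
    have hcol : U.col j = U.submatrix id j.succAbove *ᵥ (-(v j)⁻¹ • j.removeNth v) := by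
      rw [neg_smul, Matrix.mulVec_neg, Matrix.mulVec_smul, ← smul_neg,
        ← eq_neg_of_add_eq_zero_left hv, inv_smul_smul₀ hne]
    rw [hcol, olsRss_mulVec_self hV] at hpos
    exact hpos.false
  have hrest : j.removeNth v = 0 := by
    refine posDef_transpose_mul_self_iff.1 hV ?_
    simpa [hvj] using hv
  rw [← j.insertNth_self_removeNth v, hvj, hrest]
  ext k
  cases k using j.succAboveCases <;> simp

/-- The residual of a column regressed on the others is orthogonal to the others, so it is a
multiple of a column of `U (Uᵀ U)⁻¹`. -/
theorem inv_gram_diag (hV : ((U.submatrix id j.succAbove)ᵀ * U.submatrix id j.succAbove).PosDef)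
    (hpos : 0 < olsRss (U.submatrix id j.succAbove) (U.col j)) :
    (Uᵀ * U)⁻¹ j j = (olsRss (U.submatrix id j.succAbove) (U.col j))⁻¹ := by
  set V := U.submatrix id j.succAbove
  set z := U.col j - V *ᵥ betaFull V (U.col j) with hz
  set v : Fin (q + 1) → ℝ := j.insertNth 1 (-betaFull V (U.col j)) with hv
  have hUv : U *ᵥ v = z := by
    rw [mulVec_eq_col_add_submatrix_mulVec U j, hv, Fin.insertNth_apply_same, one_smul,
      Fin.removeNth_insertNth, Matrix.mulVec_neg, hz, sub_eq_add_neg]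
  have hUz : Uᵀ *ᵥ z = Pi.single j (olsRss V (U.col j)) := by
    ext k
    refine Fin.succAboveCases j ?_ (fun k => ?_) k
    · rw [Pi.single_eq_same, ← dotProduct_residual hV]
      rfl
    · rw [Pi.single_eq_of_ne (Fin.succAbove_ne j k)]
      exact congrFun (transpose_mulVec_residual hV (U.col j)) k
  have hsolve : v = (Uᵀ * U)⁻¹ *ᵥ Pi.single j (olsRss V (U.col j)) := by
    rw [← hUz, ← hUv, Matrix.mulVec_mulVec _ Uᵀ U, Matrix.mulVec_mulVec, Matrix.nonsing_inv_mul _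
      (transpose_mul_self_isUnit_det (posDef_gram_of_olsRss_col_pos hV hpos)), Matrix.one_mulVec]
  have hentry := congrFun hsolve j
  rw [hv, Fin.insertNth_apply_same, Matrix.mulVec_single] at hentry
  exact eq_inv_of_mul_eq_one_left hentry.symm

end GramColumn

section QuadraticForm

variable {α ι : Type*} {mα : MeasurableSpace α} [Fintype ι] {μ : Measure α} {Z : α → ι → ℝ}
  {C : Matrix ι ι ℝ}

theorem hasIntegral_dotProduct_mulVec (hZ : ∀ i j, HasIntegral (fun t => Z t i * Z t j) (C i j) μ)
    (M : Matrix ι ι ℝ) : HasIntegral (fun t => Z t ⬝ᵥ (M *ᵥ Z t)) (M * C).trace μ := by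
  have hsum : HasIntegral (fun t => ∑ i, ∑ j, M i j * (Z t j * Z t i))
      (∑ i, ∑ j, M i j * C j i) μ :=
    .sum fun i _ => .sum fun j _ => (hZ j i).const_mul (M i j)
  simpa only [dotProduct, Matrix.mulVec, Matrix.trace, Matrix.diag, Matrix.mul_apply,
    Finset.mul_sum, mul_left_comm, mul_comm] using hsum

end QuadraticForm

section GaussianVectors

open WithLp

variable {ι κ : Type*} [Fintype ι] [Fintype κ]

/-- The standard Gaussian distribution on `ι → ℝ`. The product measure is used instead of Mathlib's
`stdGaussian` on `EuclideanSpace ℝ ι`, so that Fubini's theorem applies to groups of coordinates. -/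
noncomputable abbrev stdVec (ι : Type*) [Fintype ι] : Measure (ι → ℝ) :=
  Measure.pi fun _ => gaussianReal 0 1

section

theorem hasIntegral_id_gaussianReal (w : NNReal) : HasIntegral id 0 (gaussianReal 0 w) :=
  ⟨(memLp_id_gaussianReal 1).integrable le_rfl, integral_id_gaussianReal⟩

theorem hasIntegral_sq_gaussianReal (w : NNReal) :
    HasIntegral (fun z => z ^ 2) w (gaussianReal 0 w) :=
  ⟨(memLp_id_gaussianReal 2).integrable_sq,
    (variance_of_integral_eq_zero aemeasurable_id integral_id_gaussianReal).symm.trans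
      variance_id_gaussianReal⟩

variable [DecidableEq ι] {S : Matrix ι ι ℝ}

theorem hasIntegral_eval_multivariateGaussian (hS : S.PosSemidef) (i : ι) :
    HasIntegral (fun x : EuclideanSpace ℝ ι => x i) 0 (multivariateGaussian 0 S) :=
  (hasIntegral_id_gaussianReal (S i i).toNNReal).comp_hasLaw
    (measurePreserving_eval_multivariateGaussian (μ := 0) hS (i := i)).hasLaw

theorem hasIntegral_mul_multivariateGaussian (hS : S.PosSemidef) (i j : ι) :
    HasIntegral (fun x => x i * x j) (S i j) (multivariateGaussian 0 S) := by
  have hcoord (i : ι) : MemLp (fun x : EuclideanSpace ℝ ι => x i) 2 (multivariateGaussian 0 S) :=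
    (memLp_id_gaussianReal 2).comp_measurePreserving
      (measurePreserving_eval_multivariateGaussian hS)
  refine ⟨(hcoord i).integrable_mul (hcoord j), ?_⟩
  have hcov := covariance_eval_multivariateGaussian (μ := 0) hS i j
  rw [covariance_eq_sub (hcoord i) (hcoord j), (hasIntegral_eval_multivariateGaussian hS i).2,
    zero_mul, sub_zero] at hcov
  exact hcov

theorem measurePreserving_toLp_stdVec :
    MeasurePreserving (toLp 2) (stdVec ι) (multivariateGaussian 0 (1 : Matrix ι ι ℝ)) :=
  ⟨by fun_prop, by rw [map_pi_eq_stdGaussian, multivariateGaussian_zero_one]⟩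

theorem hasIntegral_mul_stdVec (i j : ι) :
    HasIntegral (fun c => c i * c j) ((1 : Matrix ι ι ℝ) i j) (stdVec ι) :=
  (hasIntegral_mul_multivariateGaussian .one i j).comp_hasLaw measurePreserving_toLp_stdVec.hasLaw

theorem measurePreserving_mulVec_multivariateGaussian [DecidableEq κ] (hS : S.PosSemidef)
    {N : Matrix ι κ ℝ} (hN : Nᵀ * S * N = 1) :
    MeasurePreserving (fun x : EuclideanSpace ℝ ι => Nᵀ *ᵥ x.ofLp) (multivariateGaussian 0 S)
      (stdVec κ) := by
  have hmeas : Measurable (fun x : EuclideanSpace ℝ ι => Nᵀ *ᵥ x.ofLp) := by fun_prop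
  refine ⟨hmeas, (MeasurableEquiv.toLp 2 (κ → ℝ)).map_measurableEquiv_injective ?_⟩
  rw [MeasurableEquiv.coe_toLp, map_pi_eq_stdGaussian, Measure.map_map (by fun_prop) hmeas]
  refine Measure.ext_of_charFun (funext fun t => ?_)
  have hinner (x : EuclideanSpace ℝ ι) :
      inner ℝ (toLp 2 (Nᵀ *ᵥ x.ofLp)) t = inner ℝ x (toLp 2 (N *ᵥ t.ofLp)) := by
    simp only [EuclideanSpace.inner_eq_star_dotProduct, star_trivial]
    rw [Matrix.dotProduct_mulVec, Matrix.vecMul_transpose]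
  have hquad : (N *ᵥ t.ofLp) ⬝ᵥ (S *ᵥ (N *ᵥ t.ofLp)) = ‖t‖ ^ 2 := by
    rw [Matrix.mulVec_mulVec, ← Matrix.vecMul_transpose, ← Matrix.dotProduct_mulVec,
      Matrix.mulVec_mulVec, ← Matrix.mul_assoc, hN, Matrix.one_mulVec,
      EuclideanSpace.real_norm_sq_eq]
    simp only [dotProduct, sq]
  rw [charFun_stdGaussian, charFun_apply, integral_map (by fun_prop) (by fun_prop)]
  simp only [Function.comp_apply, hinner]
  rw [← charFun_apply, charFun_multivariateGaussian hS, inner_zero_right, ofLp_toLp, hquad]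
  push_cast
  ring_nf

end

theorem hasIntegral_sum_sq_mulVec_stdVec (L : Matrix κ ι ℝ) :
    HasIntegral (fun c => ∑ i, (L *ᵥ c) i ^ 2) (L * Lᵀ).trace (stdVec ι) := by
  classical
  convert hasIntegral_dotProduct_mulVec hasIntegral_mul_stdVec (Lᵀ * L) using 1
  · funext c
    rw [← Matrix.mulVec_mulVec, Matrix.dotProduct_mulVec, Matrix.vecMul_transpose]
    simp only [dotProduct, sq]
  · rw [Matrix.mul_one, Matrix.trace_mul_comm]

theorem measurePreserving_add_mulVec {κ' : Type*} [Fintype κ'] [DecidableEq κ] {W : Matrix κ ι ℝ}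
    {M : Matrix κ κ' ℝ} (h : W * Wᵀ + M * Mᵀ = 1) :
    MeasurePreserving (fun z : (ι → ℝ) × (κ' → ℝ) => W *ᵥ z.1 + M *ᵥ z.2)
      ((stdVec ι).prod (stdVec κ')) (stdVec κ) := by
  classical
  have hrotation := measurePreserving_mulVec_multivariateGaussian (S := 1) .one
    (N := Matrix.fromRows Wᵀ Mᵀ) (by
      rw [Matrix.mul_one, Matrix.transpose_fromRows, Matrix.fromCols_mul_fromRows,
        Matrix.transpose_transpose, Matrix.transpose_transpose, h])
  convert hrotation.comp (measurePreserving_toLp_stdVec.comp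
    (measurePreserving_sumPiEquivProdPi_symm fun _ : ι ⊕ κ' => gaussianReal 0 1)) using 1
  ext z i
  simp only [Function.comp, Matrix.transpose_fromRows, Matrix.transpose_transpose,
    Matrix.fromCols_mulVec]
  rfl

end GaussianVectors

section InverseChiSquared

open Filter Set Topology

theorem hasIntegral_one_add_two_mul_rpow {k : ℝ} (hk : 2 < k) :
    HasIntegral (fun s => (1 + 2 * s) ^ (-(k / 2))) (1 / (k - 2)) (volume.restrict (Ioi 0)) := by
  set F : ℝ → ℝ := fun s => -((1 + 2 * s) ^ (1 - k / 2)) / (k - 2)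
  have hk' : k - 2 ≠ 0 := (sub_pos.2 hk).ne'
  have hderiv : ∀ s ∈ Ici (0 : ℝ), HasDerivAt F ((1 + 2 * s) ^ (-(k / 2))) s := fun s hs => by
    have hlin : HasDerivAt (fun s : ℝ => 1 + 2 * s) 2 s := by
      simpa using ((hasDerivAt_id s).const_mul 2).const_add 1
    have hpos : 1 + 2 * s ≠ 0 := by linarith [mem_Ici.1 hs]
    refine (((hlin.rpow_const (p := 1 - k / 2) (Or.inl hpos)).neg).div_const (k - 2)).congr_deriv ?_
    rw [sub_sub_cancel_left]
    field_simp
    ring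
  have hnonneg : ∀ s ∈ Ioi (0 : ℝ), 0 ≤ (1 + 2 * s) ^ (-(k / 2)) := fun s hs =>
    Real.rpow_nonneg (by linarith [mem_Ioi.1 hs]) _
  have hlim : Tendsto F atTop (𝓝 0) := by
    have hlin : Tendsto (fun s : ℝ => 1 + 2 * s) atTop atTop :=
      tendsto_atTop_add_const_left _ _ (tendsto_id.const_mul_atTop two_pos)
    simpa [F, Function.comp_def] using
      (((tendsto_rpow_neg_atTop (y := k / 2 - 1) (by linarith)).comp hlin).neg).div_const (k - 2)
  refine ⟨integrableOn_Ioi_deriv_of_nonneg' hderiv hnonneg hlim, ?_⟩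
  rw [integral_Ioi_of_hasDerivAt_of_nonneg' hderiv hnonneg hlim]
  simp [F, neg_div]

theorem hasIntegral_exp_neg_mul_sq_gaussianReal {s : ℝ} (hs : 0 < s) :
    HasIntegral (fun z => Real.exp (-s * z ^ 2)) ((1 + 2 * s) ^ (-(1 / 2) : ℝ))
      (gaussianReal 0 1) := by
  have hexp_le (z : ℝ) : ‖Real.exp (-s * z ^ 2)‖ ≤ 1 := by
    rw [Real.norm_of_nonneg (Real.exp_pos _).le, Real.exp_le_one_iff, neg_mul]
    exact neg_nonpos.2 (by positivity)
  refine ⟨.of_bound (by fun_prop) 1 (ae_of_all _ hexp_le), ?_⟩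
  have hdensity (z : ℝ) : gaussianPDFReal 0 1 z • Real.exp (-s * z ^ 2) =
      (√(2 * Real.pi))⁻¹ * Real.exp (-(s + 1 / 2) * z ^ 2) := by
    simp only [gaussianPDFReal, smul_eq_mul, NNReal.coe_one, mul_one, sub_zero]
    rw [mul_assoc, ← Real.exp_add]
    ring_nf
  simp only [integral_gaussianReal_eq_integral_smul one_ne_zero, hdensity]
  rw [integral_const_mul, integral_gaussian, ← Real.sqrt_inv, ← Real.sqrt_mul (by positivity),
    Real.rpow_neg (by positivity), ← Real.sqrt_eq_rpow, ← Real.sqrt_inv]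
  congr 1
  have := Real.pi_pos
  field_simp
  ring

theorem hasIntegral_exp_neg_mul_sum_sq (k : ℕ) {s : ℝ} (hs : 0 < s) :
    HasIntegral (fun c => Real.exp (-s * ∑ i, c i ^ 2)) ((1 + 2 * s) ^ (-((k : ℝ) / 2)))
      (stdVec (Fin k)) := by
  have hcoord := hasIntegral_exp_neg_mul_sq_gaussianReal hs
  simp only [Finset.mul_sum, Real.exp_sum]
  refine ⟨.fintype_prod fun _ => hcoord.1, ?_⟩
  rw [integral_fintype_prod_eq_prod (fun _ (z : ℝ) => Real.exp (-s * z ^ 2)), hcoord.2,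
    Finset.prod_const, Finset.card_univ, Fintype.card_fin, ← Real.rpow_natCast,
    ← Real.rpow_mul (by positivity)]
  ring_nf

/-- Both sides are `0` at `a = 0`, where the integral diverges. -/
theorem integral_exp_neg_mul_Ioi {a : ℝ} (ha : 0 ≤ a) :
    ∫ s in Ioi 0, Real.exp (-s * a) = a⁻¹ := by
  obtain rfl | ha := ha.eq_or_lt
  · simp [Measure.real]
  · simpa [mul_comm a] using integral_exp_mul_Ioi (neg_lt_zero.2 ha) 0

/-- The mean of the inverse chi-squared distribution, from `|c|⁻² = ∫₀^∞ exp (-s |c|²) ds`. -/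
theorem hasIntegral_inv_sum_sq {k : ℕ} (hk : 2 < k) :
    HasIntegral (fun c => (∑ i, c i ^ 2)⁻¹) (1 / ((k : ℝ) - 2)) (stdVec (Fin k)) := by
  have hlaplace : HasIntegral (fun z : ℝ × (Fin k → ℝ) => Real.exp (-z.1 * ∑ i, z.2 i ^ 2))
      (1 / ((k : ℝ) - 2)) ((volume.restrict (Ioi 0)).prod (stdVec (Fin k))) :=
    .prod_of_nonneg (by fun_prop) (fun _ => (Real.exp_pos _).le)
      ((ae_restrict_mem measurableSet_Ioi).mono fun s hs => hasIntegral_exp_neg_mul_sum_sq k hs)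
      (hasIntegral_one_add_two_mul_rpow (by exact_mod_cast hk))
  simpa only [integral_exp_neg_mul_Ioi (Finset.sum_nonneg fun _ _ => sq_nonneg _)] using
    hlaplace.integral_prod_right

end InverseChiSquared

section Measurability

variable {n q : ℕ}

theorem measurable_det_gram :
    Measurable fun U : Fin n → Fin q → ℝ => ((Matrix.of U)ᵀ * Matrix.of U).det :=
  (Continuous.matrix_det (by fun_prop)).measurable

theorem measurable_inv_gram_apply (i j : Fin q) :
    Measurable fun U : Fin n → Fin q → ℝ => ((Matrix.of U)ᵀ * Matrix.of U)⁻¹ i j := by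
  have hadjugate : Continuous fun U : Fin n → Fin q → ℝ =>
      ((Matrix.of U)ᵀ * Matrix.of U).adjugate i j :=
    (Continuous.matrix_adjugate (by fun_prop)).matrix_elem i j
  simp only [Matrix.inv_def, Ring.inverse_eq_inv', Matrix.smul_apply, smul_eq_mul]
  exact measurable_det_gram.inv.mul hadjugate.measurable

theorem measurable_betaFull (j : Fin q) :
    Measurable fun z : (Fin n → Fin q → ℝ) × (Fin n → ℝ) => betaFull (Matrix.of z.1) z.2 j := by
  have hinv (k : Fin q) : Measurable fun z : (Fin n → Fin q → ℝ) × (Fin n → ℝ) =>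
      ((Matrix.of z.1)ᵀ * Matrix.of z.1)⁻¹ j k :=
    (measurable_inv_gram_apply j k).comp measurable_fst
  simp only [betaFull, Matrix.mulVec, dotProduct, Matrix.transpose_apply, Matrix.of_apply]
  exact Finset.measurable_fun_sum _ fun k _ => (hinv k).mul (by fun_prop)

theorem measurable_olsRss :
    Measurable fun z : (Fin n → Fin q → ℝ) × (Fin n → ℝ) => olsRss (Matrix.of z.1) z.2 := by
  have hbeta := measurable_betaFull (n := n) (q := q)
  simp only [olsRss, Matrix.mulVec, dotProduct]
  fun_prop

end Measurability

section FixedDesign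

variable {n q : ℕ} {U : Matrix (Fin n) (Fin q) ℝ}

theorem continuous_betaFull (U : Matrix (Fin n) (Fin q) ℝ) : Continuous (betaFull U) := by
  unfold betaFull
  fun_prop

theorem continuous_olsRss (U : Matrix (Fin n) (Fin q) ℝ) : Continuous (olsRss U) := by
  have hbeta := continuous_betaFull U
  unfold olsRss
  fun_prop

theorem ae_sum_sq_pos {ι : Type*} [Fintype ι] [Nonempty ι] :
    ∀ᵐ c ∂stdVec ι, 0 < ∑ i, c i ^ 2 := by
  have : NullSingletonClass (gaussianReal 0 1) := nullSingletonClass_gaussianReal one_ne_zero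
  let i : ι := Classical.arbitrary ι
  filter_upwards [Measure.ae_eval_ne (μ := fun _ => gaussianReal 0 1) i 0] with c hc
  exact Finset.sum_pos' (fun _ _ => sq_nonneg _) ⟨i, Finset.mem_univ i, sq_pos_of_ne_zero hc⟩

theorem ae_olsRss_pos (hU : (Uᵀ * U).PosDef) (hq : q < n) :
    ∀ᵐ e ∂stdVec (Fin n), 0 < olsRss U e := by
  obtain ⟨k, rfl⟩ := Nat.exists_eq_add_of_le' hq.le
  have : Nonempty (Fin k) := ⟨⟨0, by lia⟩⟩
  obtain ⟨L, M, hL, hM⟩ := exists_orthonormal_coordinates hU rfl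
  have hcoords := measurePreserving_add_mulVec (mul_transpose_add_mul_transpose_eq_one hL hM)
  have hmeas : MeasurableSet {e | 0 < olsRss U e} :=
    measurableSet_lt measurable_const (continuous_olsRss U).measurable
  rw [← hcoords.map_eq, ae_map_iff hcoords.aemeasurable hmeas]
  simp only [olsRss_coordinates hL hM]
  exact Measure.quasiMeasurePreserving_snd.ae ae_sum_sq_pos

/-- The least squares estimator and the residual sum of squares are independent, and the latter has
a chi-squared distribution with `n - q` degrees of freedom. -/
theorem hasIntegral_betaFull_mul_inv_olsRss (hU : (Uᵀ * U).PosDef) (hq : q + 2 < n)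
    {g : (Fin q → ℝ) → ℝ} {a : ℝ} (hg : Measurable g)
    (ha : HasIntegral (fun e => g (betaFull U e)) a (stdVec (Fin n))) :
    HasIntegral (fun e => g (betaFull U e) * (olsRss U e)⁻¹) (a * (1 / ((n : ℝ) - q - 2)))
      (stdVec (Fin n)) := by
  obtain ⟨k, rfl⟩ := Nat.exists_eq_add_of_le' (show q ≤ n by lia)
  obtain ⟨L, M, hL, hM⟩ := exists_orthonormal_coordinates hU rfl
  have hcoords := (measurePreserving_add_mulVec
    (mul_transpose_add_mul_transpose_eq_one hL hM)).hasLaw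
  have hbeta : HasIntegral (fun b => g (L *ᵥ b)) a (stdVec (Fin q)) := by
    refine .of_comp_hasLaw (ν := (stdVec (Fin q)).prod (stdVec (Fin k)))
      measurePreserving_fst.hasLaw (hg.comp (by fun_prop)).aestronglyMeasurable ?_
    simpa only [betaFull_coordinates hL hM.mul_eq_zero] using ha.comp_hasLaw hcoords
  refine HasIntegral.of_comp_hasLaw hcoords
    ((hg.comp (continuous_betaFull U).measurable).mul
      (continuous_olsRss U).measurable.inv).aestronglyMeasurable ?_
  simp only [betaFull_coordinates hL hM.mul_eq_zero, olsRss_coordinates hL hM]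
  convert hbeta.mul_prod (hasIntegral_inv_sum_sq (k := k) (by lia)) using 4
  push_cast
  ring

theorem hasIntegral_inv_olsRss (hU : (Uᵀ * U).PosDef) (hq : q + 2 < n) :
    HasIntegral (fun e => (olsRss U e)⁻¹) (1 / ((n : ℝ) - q - 2)) (stdVec (Fin n)) := by
  simpa only [one_mul] using
    hasIntegral_betaFull_mul_inv_olsRss hU hq measurable_const (hasIntegral_const 1)

theorem hasIntegral_sum_sq_betaFull (hU : (Uᵀ * U).PosDef) :
    HasIntegral (fun e => ∑ j, betaFull U e j ^ 2) (Uᵀ * U)⁻¹.trace (stdVec (Fin n)) := by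
  convert hasIntegral_sum_sq_mulVec_stdVec ((Uᵀ * U)⁻¹ * Uᵀ) using 1
  · simp only [betaFull, Matrix.mulVec_mulVec]
  · rw [Matrix.transpose_mul, Matrix.transpose_transpose, Matrix.transpose_nonsing_inv,
      Matrix.transpose_mul, Matrix.transpose_transpose, Matrix.mul_assoc, ← Matrix.mul_assoc Uᵀ,
      Matrix.mul_nonsing_inv _ (transpose_mul_self_isUnit_det hU), Matrix.mul_one]

end FixedDesign

section RandomDesign

variable {n q : ℕ}

/-- The law of an `n × q` matrix with independent standard Gaussian entries, as a measure on
`Fin n → Fin q → ℝ` because Mathlib has no measurable space structure on `Matrix`. -/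
noncomputable abbrev stdMat (n q : ℕ) : Measure (Fin n → Fin q → ℝ) :=
  Measure.pi fun _ => stdVec (Fin q)

/-- The law of a regression of noise on noise: an `n × q` design with independent standard Gaussian
entries, and an independent standard Gaussian response. -/
noncomputable abbrev stdRegression (n q : ℕ) : Measure ((Fin n → Fin q → ℝ) × (Fin n → ℝ)) :=
  (stdMat n q).prod (stdVec (Fin n))

theorem measurePreserving_submatrix_col (n : ℕ) {q : ℕ} (j : Fin (q + 1)) :
    MeasurePreserving (fun U : Fin n → Fin (q + 1) → ℝ =>
      (((Matrix.of U).submatrix id j.succAbove, (Matrix.of U).col j) :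
        (Fin n → Fin q → ℝ) × (Fin n → ℝ))) (stdMat n (q + 1)) (stdRegression n q) := by
  have hrows := measurePreserving_pi (fun _ : Fin n => stdVec (Fin (q + 1)))
    (fun _ => (gaussianReal 0 1).prod (stdVec (Fin q)))
    (fun _ => measurePreserving_piFinSuccAbove (fun _ : Fin (q + 1) => gaussianReal 0 1) j)
  have hcols := measurePreserving_arrowProdEquivProdArrow ℝ (Fin q → ℝ) (Fin n)
    (fun _ => gaussianReal 0 1) (fun _ => stdVec (Fin q))
  exact Measure.measurePreserving_swap.comp (hcols.comp hrows)

theorem ae_stdRegression_olsRss_pos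
    (hgram : ∀ᵐ U ∂stdMat n q, ((Matrix.of U)ᵀ * Matrix.of U).PosDef) (hq : q < n) :
    ∀ᵐ z ∂stdRegression n q, 0 < olsRss (Matrix.of z.1) z.2 :=
  (Measure.ae_prod_iff_ae_ae (measurableSet_lt measurable_const measurable_olsRss)).2
    (hgram.mono fun _ hU => ae_olsRss_pos hU hq)

theorem ae_posDef_gram (hq : q ≤ n) :
    ∀ᵐ U ∂stdMat n q, ((Matrix.of U)ᵀ * Matrix.of U).PosDef := by
  induction q with
  | zero =>
    exact ae_of_all _ fun U =>
      posDef_transpose_mul_self_iff.2 (Function.injective_of_subsingleton _)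
  | succ q ih =>
    have hgram := ih (by lia)
    have hsplit := (measurePreserving_submatrix_col n (Fin.last q)).quasiMeasurePreserving
    filter_upwards [hsplit.ae (Measure.quasiMeasurePreserving_fst.ae hgram),
      hsplit.ae (ae_stdRegression_olsRss_pos hgram hq)] with U hV hpos
    exact posDef_gram_of_olsRss_col_pos hV hpos

theorem ae_posDef_gram_and_olsRss_pos (hq : q < n) : ∀ᵐ z ∂stdRegression n q,
    ((Matrix.of z.1)ᵀ * Matrix.of z.1).PosDef ∧ 0 < olsRss (Matrix.of z.1) z.2 :=
  (Measure.quasiMeasurePreserving_fst.ae (ae_posDef_gram hq.le)).and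
    (ae_stdRegression_olsRss_pos (ae_posDef_gram hq.le) hq)

theorem hasIntegral_inv_olsRss_stdRegression (hq : q + 2 < n) :
    HasIntegral (fun z => (olsRss (Matrix.of z.1) z.2)⁻¹) (1 / ((n : ℝ) - q - 2))
      (stdRegression n q) :=
  .prod_of_nonneg measurable_olsRss.inv.aestronglyMeasurable
    (fun _ => inv_nonneg.2 (olsRss_nonneg _ _))
    ((ae_posDef_gram (by lia)).mono fun _ hU => hasIntegral_inv_olsRss hU hq) (hasIntegral_const _)

theorem hasIntegral_inv_gram_diag (hq : q + 2 < n) (j : Fin (q + 1)) :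
    HasIntegral (fun U => ((Matrix.of U)ᵀ * Matrix.of U)⁻¹ j j) (1 / ((n : ℝ) - q - 2))
      (stdMat n (q + 1)) := by
  have hsplit := measurePreserving_submatrix_col n j
  refine ((hasIntegral_inv_olsRss_stdRegression hq).comp_hasLaw hsplit.hasLaw).congr ?_
  filter_upwards [hsplit.quasiMeasurePreserving.ae (ae_posDef_gram_and_olsRss_pos (by lia))]
    with U hU
  exact (inv_gram_diag hU.1 hU.2).symm

theorem hasIntegral_trace_inv_gram (hq : q + 1 < n) :
    HasIntegral (fun U => ((Matrix.of U)ᵀ * Matrix.of U)⁻¹.trace) (q / ((n : ℝ) - q - 1))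
      (stdMat n q) := by
  obtain _ | q := q
  · simpa [Matrix.trace] using hasIntegral_const (0 : ℝ)
  convert HasIntegral.sum fun j (_ : j ∈ Finset.univ) => hasIntegral_inv_gram_diag hq j using 1
  · rfl
  · rw [Finset.sum_const, Finset.card_univ, Fintype.card_fin, nsmul_eq_mul, mul_one_div]
    push_cast
    ring_nf

theorem hasIntegral_one_add_sum_sq_betaFull_mul_inv_olsRss (hq : q + 2 < n) :
    HasIntegral
      (fun z => (1 + ∑ j, betaFull (Matrix.of z.1) z.2 j ^ 2) * (olsRss (Matrix.of z.1) z.2)⁻¹)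
      (((n : ℝ) - 1) / (((n : ℝ) - q - 1) * ((n : ℝ) - q - 2))) (stdRegression n q) := by
  have hbeta := measurable_betaFull (n := n) (q := q)
  have hrss := measurable_olsRss (n := n) (q := q)
  have hmean := ((hasIntegral_const 1).add (hasIntegral_trace_inv_gram (n := n) (q := q)
    (by lia))).const_mul (1 / ((n : ℝ) - q - 2))
  have hvalue : 1 / ((n : ℝ) - q - 2) * (1 + q / ((n : ℝ) - q - 1)) =
      ((n : ℝ) - 1) / (((n : ℝ) - q - 1) * ((n : ℝ) - q - 2)) := by
    have hn : (q : ℝ) + 2 < n := by exact_mod_cast hq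
    have hne : (n : ℝ) - q - 1 ≠ 0 := by linarith
    field_simp
    ring
  rw [hvalue] at hmean
  refine .prod_of_nonneg (Measurable.aestronglyMeasurable (by fun_prop))
    (fun z => mul_nonneg (by positivity) (inv_nonneg.2 (olsRss_nonneg _ _))) ?_ hmean
  filter_upwards [ae_posDef_gram (n := n) (q := q) (by lia)] with U hU
  rw [mul_comm (1 / _)]
  exact hasIntegral_betaFull_mul_inv_olsRss (g := fun b => 1 + ∑ j, b j ^ 2) hU hq (by fun_prop)
    ((hasIntegral_const 1).add (hasIntegral_sum_sq_betaFull hU))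

theorem abs_log_le_add_inv {s : ℝ} (hs : 0 < s) : |Real.log s| ≤ s + s⁻¹ :=
  have hinv := inv_pos.2 hs
  abs_le.2 ⟨by linarith [Real.one_sub_inv_le_log_of_pos hs],
    by linarith [Real.log_le_sub_one_of_pos hs]⟩

theorem integrable_log_olsRss (hq : q + 2 < n) :
    Integrable (fun z => Real.log (olsRss (Matrix.of z.1) z.2)) (stdRegression n q) := by
  have hresponse : HasIntegral (fun e => ∑ i, e i ^ 2) _ (stdVec (Fin n)) :=
    .sum fun i _ => by simpa only [sq] using hasIntegral_mul_stdVec i i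
  refine ((hresponse.1.comp_snd _).add (hasIntegral_inv_olsRss_stdRegression hq).1).mono'
    measurable_olsRss.log.aestronglyMeasurable ?_
  filter_upwards [ae_posDef_gram_and_olsRss_pos (n := n) (q := q) (by lia)] with z ⟨hgram, hpos⟩
  exact (abs_log_le_add_inv hpos).trans (add_le_add_left (olsRss_le_sum_sq hgram z.2) _)

theorem integrable_log_det_gram (hq : q + 1 < n) :
    Integrable (fun U => Real.log ((Matrix.of U)ᵀ * Matrix.of U).det) (stdMat n q) := by
  have htrace : HasIntegral (fun U : Fin n → Fin q → ℝ => ∑ j, ∑ i, U i j * U i j) _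
      (stdMat n q) :=
    .sum fun j _ => .sum fun i _ =>
      (hasIntegral_mul_stdVec j j).comp_hasLaw
        (measurePreserving_eval (fun _ => stdVec (Fin q)) i).hasLaw
  refine (htrace.1.add (hasIntegral_trace_inv_gram hq).1).mono'
    measurable_det_gram.log.aestronglyMeasurable ?_
  filter_upwards [ae_posDef_gram (n := n) (q := q) (by lia)] with U hU
  exact abs_log_det_le_trace_add_trace_inv hU

end RandomDesign

section StandardCoordinates

variable {n p m q : ℕ} {Ω : Type*} {x : Fin n → Ω → EuclideanSpace ℝ (Fin p)}
  {ε : Fin n → Ω → ℝ} {S : Matrix (Fin p) (Fin p) ℝ} {v : ℝ} {R : Matrix (Fin m) (Fin p) ℝ}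
  {N : Matrix (Fin p) (Fin q) ℝ} {ω : Ω}

/-- The regression of the errors on the design, in the coordinates given by the columns of `N` and
with the errors scaled to unit variance. -/
noncomputable def stdSample (x : Fin n → Ω → EuclideanSpace ℝ (Fin p)) (ε : Fin n → Ω → ℝ) (v : ℝ)
    (N : Matrix (Fin p) (Fin q) ℝ) (ω : Ω) : (Fin n → Fin q → ℝ) × (Fin n → ℝ) :=
  (design x ω * N, fun i => ε i ω / √v)

theorem response_eq_add_smul_stdSample (hv : 0 < v) (β₀ : Fin p → ℝ)
    (N : Matrix (Fin p) (Fin q) ℝ) (ω : Ω) :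
    response x ε β₀ ω = design x ω *ᵥ β₀ + √v • (stdSample x ε v N ω).2 := by
  ext i
  simp only [response, stdSample, Pi.add_apply, Pi.smul_apply, smul_eq_mul,
    mul_div_cancel₀ _ (Real.sqrt_pos.2 hv).ne']

theorem IsOrthonormalKerBasis.rss_response_eq (hN : IsOrthonormalKerBasis S R N) (hv : 0 < v)
    (hX : ((design x ω)ᵀ * design x ω).PosDef) (hR : R.rank = m) (β₀ : Fin p → ℝ) :
    rss R (R *ᵥ β₀) (design x ω) (response x ε β₀ ω) =
      v * olsRss (Matrix.of (stdSample x ε v N ω).1) (stdSample x ε v N ω).2 := by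
  rw [response_eq_add_smul_stdSample hv β₀ N, hN.rss_eq hX hR, olsRss_smul, Real.sq_sqrt hv.le]
  rfl

theorem IsOrthonormalKerBasis.betaHat_response_quadForm_eq (hN : IsOrthonormalKerBasis S R N)
    (hv : 0 < v) (hX : ((design x ω)ᵀ * design x ω).PosDef) (hR : R.rank = m) (β₀ : Fin p → ℝ) :
    (betaHat R (R *ᵥ β₀) (design x ω) (response x ε β₀ ω) - β₀) ⬝ᵥ
        (S *ᵥ (betaHat R (R *ᵥ β₀) (design x ω) (response x ε β₀ ω) - β₀)) =
      v * ∑ j, betaFull (Matrix.of (stdSample x ε v N ω).1) (stdSample x ε v N ω).2 j ^ 2 := by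
  rw [response_eq_add_smul_stdSample hv β₀ N, hN.betaHat_eq hX hR, add_sub_cancel_left,
    dotProduct_mulVec_mulVec_eq_sum_sq hN.orthonormal, betaFull_smul, Finset.mul_sum]
  simp only [Pi.smul_apply, smul_eq_mul, mul_pow, Real.sq_sqrt hv.le]
  rfl

end StandardCoordinates

section Design

variable {n p m q : ℕ} {Ω : Type*} [MeasurableSpace Ω] {P : Measure Ω}
  {x : Fin n → Ω → EuclideanSpace ℝ (Fin p)} {ε : Fin n → Ω → ℝ}
  {S : Matrix (Fin p) (Fin p) ℝ} {v : ℝ}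

section Moments

variable (h : IsGaussianDesign P x ε S v)
include h

theorem IsGaussianDesign.hasIntegral_err (i : Fin n) : HasIntegral (ε i) 0 P :=
  (hasIntegral_id_gaussianReal _).comp_hasLaw (h.law_err i)

theorem IsGaussianDesign.hasIntegral_err_sq (hv : 0 ≤ v) (i : Fin n) :
    HasIntegral (fun ω => ε i ω ^ 2) v P := by
  simpa only [Real.coe_toNNReal _ hv] using
    (hasIntegral_sq_gaussianReal v.toNNReal).comp_hasLaw (h.law_err i)

theorem IsGaussianDesign.hasIntegral_row_mul_row (hS : S.PosSemidef) (i : Fin n) (j k : Fin p) :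
    HasIntegral (fun ω => x i ω j * x i ω k) (S j k) P :=
  (hasIntegral_mul_multivariateGaussian hS j k).comp_hasLaw (h.law_row i)

theorem IsGaussianDesign.hasIntegral_trace_mul_gram (hS : S.PosSemidef)
    (M : Matrix (Fin p) (Fin p) ℝ) :
    HasIntegral (fun ω => (M * ((design x ω)ᵀ * design x ω)).trace) (n * (M * S).trace) P := by
  have hsum : HasIntegral (fun ω => ∑ i, design x ω i ⬝ᵥ (M *ᵥ design x ω i))
      (∑ _ : Fin n, (M * S).trace) P :=
    .sum fun i _ => hasIntegral_dotProduct_mulVec (h.hasIntegral_row_mul_row hS i) M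
  simpa only [sum_dotProduct_mulVec_eq_trace, Finset.sum_const, Finset.card_univ,
    Fintype.card_fin, nsmul_eq_mul] using hsum

theorem IsGaussianDesign.hasIntegral_design_mulVec_sq (hS : S.PosSemidef) (d : Fin p → ℝ)
    (i : Fin n) : HasIntegral (fun ω => (design x ω *ᵥ d) i ^ 2) (d ⬝ᵥ (S *ᵥ d)) P := by
  have hsum : HasIntegral (fun ω => ∑ j, ∑ k, d j * d k * (x i ω j * x i ω k))
      (∑ j, ∑ k, d j * d k * S j k) P :=
    .sum fun j _ => .sum fun k _ => (h.hasIntegral_row_mul_row hS i j k).const_mul _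
  convert hsum using 1
  · funext ω
    rw [sq, Matrix.mulVec, dotProduct, Finset.sum_mul_sum]
    exact Finset.sum_congr rfl fun j _ => Finset.sum_congr rfl fun k _ => by
      rw [design, Matrix.of_apply, Matrix.of_apply]
      ring
  · simp only [dotProduct, Matrix.mulVec, Finset.mul_sum]
    exact Finset.sum_congr rfl fun j _ => Finset.sum_congr rfl fun k _ => by ring

theorem IsGaussianDesign.hasIntegral_design_mulVec_mul_err (hS : S.PosSemidef) (d : Fin p → ℝ)
    (i : Fin n) : HasIntegral (fun ω => (design x ω *ᵥ d) i * ε i ω) 0 P := by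
  have hmean : HasIntegral (fun ω => ∑ j, d j * x i ω j) (∑ j, d j * 0) P :=
    .sum fun j _ => .const_mul _
      ((hasIntegral_eval_multivariateGaussian hS j).comp_hasLaw (h.law_row i))
  have hindep : IndepFun (fun ω => ∑ j, d j * x i ω j) (ε i) P :=
    h.indep.comp (φ := fun z : Fin n → EuclideanSpace ℝ (Fin p) => ∑ j, d j * z i j)
      (ψ := fun e : Fin n → ℝ => e i) (by fun_prop) (by fun_prop)
  simpa only [design, Matrix.mulVec, dotProduct, Matrix.of_apply, mul_comm (d _), mul_zero]
    using hmean.mul_of_indepFun (h.hasIntegral_err i) hindep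

theorem IsGaussianDesign.hasIntegral_sq_err_sub (hS : S.PosSemidef) (hv : 0 ≤ v)
    (d : Fin p → ℝ) (i : Fin n) :
    HasIntegral (fun ω => (ε i ω - (design x ω *ᵥ d) i) ^ 2) (v + d ⬝ᵥ (S *ᵥ d)) P := by
  convert ((h.hasIntegral_err_sq hv i).sub
    ((h.hasIntegral_design_mulVec_mul_err hS d i).const_mul 2)).add
      (h.hasIntegral_design_mulVec_sq hS d i) using 1
  · funext ω
    ring
  · ring

variable [IsProbabilityMeasure P] in
theorem IsGaussianDesign.hasIntegral_negTwoLogLik (hS : S.PosSemidef) (hv : 0 ≤ v)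
    (β₀ : Fin p → ℝ) {θ : Params p} (hvar : 0 < θ.var) (hcov : θ.cov.PosDef) :
    HasIntegral (fun ω => negTwoLogLik (design x ω) (response x ε β₀ ω) θ)
      (n * Real.log (2 * Real.pi * θ.var)
        + n * (v + (θ.β - β₀) ⬝ᵥ (S *ᵥ (θ.β - β₀))) / θ.var + n * p * Real.log (2 * Real.pi)
        + n * Real.log θ.cov.det + n * (θ.cov⁻¹ * S).trace) P := by
  have hresidual (ω : Ω) (i : Fin n) : response x ε β₀ ω i - (design x ω *ᵥ θ.β) i =
      ε i ω - (design x ω *ᵥ (θ.β - β₀)) i := by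
    rw [Matrix.mulVec_sub, response, Pi.sub_apply]
    ring
  have hfit := HasIntegral.sum fun i (_ : i ∈ Finset.univ) =>
    h.hasIntegral_sq_err_sub hS hv (θ.β - β₀) i
  convert ((hasIntegral_const (n * Real.log (2 * Real.pi * θ.var) + n * p * Real.log (2 * Real.pi)
    + n * Real.log θ.cov.det)).add (hfit.const_mul θ.var⁻¹)).add
      (h.hasIntegral_trace_mul_gram hS θ.cov⁻¹) using 1
  · funext ω
    rw [negTwoLogLik_eq _ _ hvar hcov]
    simp only [hresidual]
    ring
  · rw [Finset.sum_const, Finset.card_univ, Fintype.card_fin, nsmul_eq_mul]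
    ring

end Moments

section Law

variable {N : Matrix (Fin p) (Fin q) ℝ}

theorem measurePreserving_div_sqrt (hv : 0 < v) :
    MeasurePreserving (fun z : ℝ => z / √v) (gaussianReal 0 v.toNNReal) (gaussianReal 0 1) := by
  refine ⟨by fun_prop, ?_⟩
  rw [gaussianReal_map_div_const, zero_div]
  congr 1
  ext
  simp [Real.sq_sqrt hv.le, hv.le, hv.ne']

theorem IsGaussianDesign.hasLaw_design_mul (h : IsGaussianDesign P x ε S v) (hS : S.PosSemidef)
    (hN : Nᵀ * S * N = 1) :
    HasLaw (fun ω => (design x ω * N : Fin n → Fin q → ℝ)) (stdMat n q) P := by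
  have hrows := measurePreserving_pi (fun _ : Fin n => multivariateGaussian 0 S)
    (fun _ => stdVec (Fin q)) (fun _ => measurePreserving_mulVec_multivariateGaussian hS hN)
  refine (hrows.comp_hasLaw (h.indep_rows.hasLaw_pi h.law_row)).congr (ae_of_all _ fun ω => ?_)
  ext i j
  simp only [Function.comp_apply, Matrix.mul_apply, design, Matrix.of_apply, Matrix.mulVec,
    dotProduct, Matrix.transpose_apply, mul_comm]

theorem IsGaussianDesign.hasLaw_err_div_sqrt (h : IsGaussianDesign P x ε S v) (hv : 0 < v) :
    HasLaw (fun ω i => ε i ω / √v) (stdVec (Fin n)) P :=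
  (measurePreserving_pi (fun _ => gaussianReal 0 v.toNNReal) (fun _ => gaussianReal 0 1)
    fun _ => measurePreserving_div_sqrt hv).comp_hasLaw (h.indep_errs.hasLaw_pi h.law_err)

theorem IsGaussianDesign.hasLaw_stdSample [IsProbabilityMeasure P]
    (h : IsGaussianDesign P x ε S v) (hS : S.PosSemidef) (hv : 0 < v) (hN : Nᵀ * S * N = 1) :
    HasLaw (stdSample x ε v N) (stdRegression n q) P := by
  have hindep : IndepFun (β := Fin n → Fin q → ℝ) (fun ω => design x ω * N)
      (fun ω i => ε i ω / √v) P := h.indep.comp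
    (φ := fun z : Fin n → EuclideanSpace ℝ (Fin p) => fun i j => ∑ k, z i k * N k j)
    (ψ := fun e : Fin n → ℝ => fun i => e i / √v) (by fun_prop) (by fun_prop)
  exact hindep.hasLaw_prod (h.hasLaw_design_mul hS hN) (h.hasLaw_err_div_sqrt hv)

end Law

end Design

section ExpectedOptimism

variable {n p m : ℕ} {Ω Ω' : Type*} [MeasurableSpace Ω] [MeasurableSpace Ω'] {P : Measure Ω}
  {P' : Measure Ω'} {x : Fin n → Ω → EuclideanSpace ℝ (Fin p)} {ε : Fin n → Ω → ℝ}
  {x' : Fin n → Ω' → EuclideanSpace ℝ (Fin p)} {ε' : Fin n → Ω' → ℝ}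
  {S : Matrix (Fin p) (Fin p) ℝ} {v : ℝ} {R : Matrix (Fin m) (Fin p) ℝ} {r : Fin m → ℝ}
  {X : Matrix (Fin n) (Fin p) ℝ} {y : Fin n → ℝ}

theorem IsGaussianDesign.integrable_negTwoLogLik_mle [IsProbabilityMeasure P']
    (h : IsGaussianDesign P' x' ε' S v) (hS : S.PosSemidef) (hv : 0 ≤ v) (hn : 0 < n)
    (hX : (Xᵀ * X).PosDef) (hR : R.rank = m) (hrss : 0 < rss R r X y) (β₀ : Fin p → ℝ) :
    Integrable (fun ω => negTwoLogLik (design x' ω) (response x' ε' β₀ ω) (mle R r X y)) P' :=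
  have hmle := mle_mem_restrictedParams hX hR hn hrss
  (h.hasIntegral_negTwoLogLik hS hv β₀ hmle.2.1 hmle.2.2).1

theorem IsGaussianDesign.optimism_eq [IsProbabilityMeasure P']
    (h : IsGaussianDesign P' x' ε' S v) (hS : S.PosSemidef) (hv : 0 ≤ v) (hn : 0 < n)
    (hX : (Xᵀ * X).PosDef) (hR : R.rank = m) (hrss : 0 < rss R r X y) (β₀ : Fin p → ℝ) :
    optimism P' (design x') (response x' ε' β₀) R r X y =
      n ^ 2 * ((v + (betaHat R r X y - β₀) ⬝ᵥ (S *ᵥ (betaHat R r X y - β₀))) / rss R r X y)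
        + n ^ 2 * ((Xᵀ * X)⁻¹ * S).trace - n * (p + 1) := by
  have hn' : (n : ℝ) ≠ 0 := Nat.cast_ne_zero.2 hn.ne'
  obtain ⟨-, hvar, hcov⟩ := mle_mem_restrictedParams hX hR hn hrss
  have hinv : ((n : ℝ)⁻¹ • (Xᵀ * X))⁻¹ = (n : ℝ) • (Xᵀ * X)⁻¹ := by
    simpa [Units.smul_def] using Matrix.inv_smul' (Xᵀ * X) (Units.mk0 (n : ℝ)⁻¹ (inv_ne_zero hn'))
      (transpose_mul_self_isUnit_det hX)
  rw [optimism, testErr, (h.hasIntegral_negTwoLogLik hS hv β₀ hvar hcov).2,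
    trainErr_eq hX hR hn hrss, mle, hinv, Matrix.smul_mul, Matrix.trace_smul, smul_eq_mul,
    Real.log_mul (by positivity) (div_ne_zero hrss.ne' hn')]
  field_simp
  ring

section Integrability

variable (h : IsGaussianDesign P x ε S v)
include h

theorem IsGaussianDesign.ae_posDef_gram (hS : S.PosDef) (hn : p ≤ n) :
    ∀ᵐ ω ∂P, ((design x ω)ᵀ * design x ω).PosDef := by
  obtain ⟨L, hL⟩ := exists_transpose_mul_mul_eq_one hS
  have hlaw := h.hasLaw_design_mul hS.posSemidef hL
  filter_upwards [ae_of_ae_map hlaw.aemeasurable (hlaw.map_eq ▸ RandomX.ae_posDef_gram hn)]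
    with ω hω
  exact posDef_gram_of_posDef_gram_mul (N := L) hω

theorem IsGaussianDesign.hasIntegral_trace_inv_gram_mul (hS : S.PosDef) (hn : p + 1 < n) :
    HasIntegral (fun ω => (((design x ω)ᵀ * design x ω)⁻¹ * S).trace)
      (p / ((n : ℝ) - p - 1)) P := by
  obtain ⟨L, hL⟩ := exists_transpose_mul_mul_eq_one hS
  simp only [← trace_inv_gram_mul hL]
  exact (hasIntegral_trace_inv_gram hn).comp_hasLaw (h.hasLaw_design_mul hS.posSemidef hL)

variable [IsProbabilityMeasure P]

theorem IsGaussianDesign.integrable_log_det_gram (hS : S.PosDef) (hn : p + 1 < n) :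
    Integrable (fun ω => Real.log ((design x ω)ᵀ * design x ω).det) P := by
  obtain ⟨L, hL⟩ := exists_transpose_mul_mul_eq_one hS
  have hstd := (HasIntegral.comp_hasLaw ⟨RandomX.integrable_log_det_gram hn, rfl⟩
    (h.hasLaw_design_mul hS.posSemidef hL)).1
  refine (hstd.sub (integrable_const (Real.log (L.det ^ 2)))).congr ?_
  filter_upwards [h.ae_posDef_gram hS (by lia)] with ω hX
  have hdet := (posDef_gram_mul hX hL).det_pos.ne'
  change Real.log ((design x ω * L)ᵀ * (design x ω * L)).det - _ = _
  rw [det_gram_mul] at hdet ⊢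
  rw [Real.log_mul (left_ne_zero_of_mul hdet) (right_ne_zero_of_mul hdet), add_sub_cancel_left]

theorem IsGaussianDesign.ae_rss_pos (hS : S.PosDef) (hv : 0 < v) (hR : R.rank = m)
    (hn : p ≤ n) (hnm : p < n + m) (β₀ : Fin p → ℝ) :
    ∀ᵐ ω ∂P, 0 < rss R (R *ᵥ β₀) (design x ω) (response x ε β₀ ω) := by
  obtain ⟨q, hq⟩ := Nat.exists_eq_add_of_le' R.rank_le_width
  obtain ⟨N, hN⟩ := exists_isOrthonormalKerBasis hS R hq.symm
  have hlaw := h.hasLaw_stdSample hS.posSemidef hv hN.orthonormal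
  filter_upwards [h.ae_posDef_gram hS hn, ae_of_ae_map hlaw.aemeasurable
    (hlaw.map_eq ▸ ae_posDef_gram_and_olsRss_pos (by lia))] with ω hX ⟨_, hpos⟩
  rw [hN.rss_response_eq hv hX hR]
  exact mul_pos hv hpos

theorem IsGaussianDesign.integrable_log_rss (hS : S.PosDef) (hv : 0 < v) (hR : R.rank = m)
    (hn : p ≤ n) (hnm : p + 2 < n + m) (β₀ : Fin p → ℝ) :
    Integrable (fun ω => Real.log (rss R (R *ᵥ β₀) (design x ω) (response x ε β₀ ω))) P := by
  obtain ⟨q, hq⟩ := Nat.exists_eq_add_of_le' R.rank_le_width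
  obtain ⟨N, hN⟩ := exists_isOrthonormalKerBasis hS R hq.symm
  have hlaw := h.hasLaw_stdSample hS.posSemidef hv hN.orthonormal
  have hstd := (HasIntegral.comp_hasLaw ⟨integrable_log_olsRss (n := n) (by lia), rfl⟩ hlaw).1
  refine ((integrable_const (Real.log v)).add hstd).congr ?_
  filter_upwards [h.ae_posDef_gram hS hn, ae_of_ae_map hlaw.aemeasurable
    (hlaw.map_eq ▸ ae_posDef_gram_and_olsRss_pos (by lia))] with ω hX ⟨_, hpos⟩
  rw [hN.rss_response_eq hv hX hR, Real.log_mul hv.ne' hpos.ne']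
  rfl

theorem IsGaussianDesign.hasIntegral_predictionError_div_rss (hS : S.PosDef) (hv : 0 < v)
    (hR : R.rank = m) (hn : p ≤ n) (hnm : p + 2 < n + m) (β₀ : Fin p → ℝ) :
    HasIntegral (fun ω =>
        (v + (betaHat R (R *ᵥ β₀) (design x ω) (response x ε β₀ ω) - β₀) ⬝ᵥ
          (S *ᵥ (betaHat R (R *ᵥ β₀) (design x ω) (response x ε β₀ ω) - β₀))) /
        rss R (R *ᵥ β₀) (design x ω) (response x ε β₀ ω))
      (((n : ℝ) - 1) / (((n : ℝ) - p + m - 2) * ((n : ℝ) - p + m - 1))) P := by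
  obtain ⟨q, hq⟩ := Nat.exists_eq_add_of_le' R.rank_le_width
  obtain ⟨N, hN⟩ := exists_isOrthonormalKerBasis hS R hq.symm
  have hp : (p : ℝ) = q + m := by rw [← hR]; exact_mod_cast hq
  have hstd := (hasIntegral_one_add_sum_sq_betaFull_mul_inv_olsRss (n := n) (by lia)).comp_hasLaw
    (h.hasLaw_stdSample hS.posSemidef hv hN.orthonormal)
  rw [show (n : ℝ) - p + m - 2 = n - q - 2 by rw [hp]; ring,
    show (n : ℝ) - p + m - 1 = n - q - 1 by rw [hp]; ring, mul_comm ((n : ℝ) - q - 2)]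
  refine hstd.congr ?_
  filter_upwards [h.ae_posDef_gram hS hn] with ω hX
  rw [hN.betaHat_response_quadForm_eq hv hX hR, hN.rss_response_eq hv hX hR, ← mul_one_add,
    mul_div_mul_left _ _ hv.ne', div_eq_mul_inv]

theorem IsGaussianDesign.integrable_trainErr (hS : S.PosDef) (hv : 0 < v) (hR : R.rank = m)
    (hn : p + 1 < n) (hnm : p + 2 < n + m) (β₀ : Fin p → ℝ) :
    Integrable (fun ω => trainErr R (R *ᵥ β₀) (design x ω) (response x ε β₀ ω)) P := by
  have hn' : (n : ℝ) ≠ 0 := Nat.cast_ne_zero.2 (by lia)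
  refine ((((h.integrable_log_rss hS hv hR (by lia) hnm β₀).const_mul n).add
    ((h.integrable_log_det_gram hS hn).const_mul n)).add (integrable_const
      (n * (p + 1) * (Real.log (2 * Real.pi) + 1 - Real.log n)))).congr ?_
  filter_upwards [h.ae_posDef_gram hS (by lia), h.ae_rss_pos hS hv hR (by lia) (by lia) β₀]
    with ω hX hrss
  rw [trainErr_eq hX hR (by lia) hrss, Real.log_div hrss.ne' hn', Matrix.det_smul, Fintype.card_fin,
    Real.log_mul (pow_ne_zero _ (inv_ne_zero hn')) hX.det_pos.ne', Real.log_pow, Real.log_inv]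
  simp only [Pi.add_apply]
  ring

theorem IsGaussianDesign.hasIntegral_optimism [IsProbabilityMeasure P']
    (hnew : IsGaussianDesign P' x' ε' S v) (hS : S.PosDef) (hv : 0 < v) (hR : R.rank = m)
    (hn : p + 1 < n) (hnm : p + 2 < n + m) (β₀ : Fin p → ℝ) :
    HasIntegral (fun ω => optimism P' (design x') (response x' ε' β₀) R (R *ᵥ β₀) (design x ω)
        (response x ε β₀ ω))
      (n * ((n * (n - 1)) / (((n : ℝ) - p + m - 2) * ((n : ℝ) - p + m - 1)))
        + n * ((n * p) / ((n : ℝ) - p - 1)) - n * (p + 1)) P := by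
  have hsum := (((h.hasIntegral_predictionError_div_rss hS hv hR (by lia) hnm β₀).const_mul
    ((n : ℝ) ^ 2)).add ((h.hasIntegral_trace_inv_gram_mul hS hn).const_mul ((n : ℝ) ^ 2))).sub
      (hasIntegral_const (n * ((p : ℝ) + 1)))
  have hvalue : n * ((n * (n - 1)) / (((n : ℝ) - p + m - 2) * ((n : ℝ) - p + m - 1)))
        + n * ((n * p) / ((n : ℝ) - p - 1)) - n * (p + 1) =
      (n : ℝ) ^ 2 * (((n : ℝ) - 1) / (((n : ℝ) - p + m - 2) * ((n : ℝ) - p + m - 1)))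
        + (n : ℝ) ^ 2 * (p / ((n : ℝ) - p - 1)) - n * (p + 1) := by ring
  rw [hvalue]
  refine hsum.congr ?_
  filter_upwards [h.ae_posDef_gram hS (by lia), h.ae_rss_pos hS hv hR (by lia) (by lia) β₀]
    with ω hX hrss
  exact (hnew.optimism_eq hS.posSemidef hv.le (by lia) hX hR hrss β₀).symm

end Integrability

end ExpectedOptimism

end RandomX

theorem mainTheorem3 {n p m : ℕ} {Ω Ω' : Type*} [MeasurableSpace Ω] [MeasurableSpace Ω']
    (P : Measure Ω) [IsProbabilityMeasure P] (P' : Measure Ω') [IsProbabilityMeasure P']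
    (x : Fin n → Ω → EuclideanSpace ℝ (Fin p)) (ε : Fin n → Ω → ℝ)
    (x' : Fin n → Ω' → EuclideanSpace ℝ (Fin p)) (ε' : Fin n → Ω' → ℝ)
    (β₀ : Fin p → ℝ) (σ₀sq : ℝ) (S₀ : Matrix (Fin p) (Fin p) ℝ)
    (R : Matrix (Fin m) (Fin p) ℝ) (r : Fin m → ℝ)
    (hσ₀ : 0 < σ₀sq) (hS₀ : S₀.PosDef)
    -- the training sample, and the new sample with the same distribution
    (htrain : IsGaussianDesign P x ε S₀ σ₀sq)
    (hnew : IsGaussianDesign P' x' ε' S₀ σ₀sq)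
    -- the restrictions are linearly independent and the true model satisfies them
    (hR : R.rank = m) (hβ₀ : R *ᵥ β₀ = r)
    -- the denominators in the claim are positive
    (hn : p + 1 < n) (hnm : p + 2 < n + m) :
    let X := design x
    let y := response x ε β₀
    let X' := design x'
    let y' := response x' ε' β₀
    -- almost surely, the joint MLE exists, is unique and has the closed form `mle`
    (∀ᵐ ω ∂P, ∀ θ, IsRestrictedMLE R r (X ω) (y ω) θ ↔ θ = mle R r (X ω) (y ω)) ∧
    -- all expectations are finite
    (∀ᵐ ω ∂P, Integrable
      (fun ω' => negTwoLogLik (X' ω') (y' ω') (mle R r (X ω) (y ω))) P') ∧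
    Integrable (fun ω => testErr P' X' y' R r (X ω) (y ω)) P ∧
    Integrable (fun ω => trainErr R r (X ω) (y ω)) P ∧
    -- the expected optimism
    (∫ ω, optimism P' X' y' R r (X ω) (y ω) ∂P =
      n * ((n * (n - 1)) / (((n : ℝ) - p + m - 2) * ((n : ℝ) - p + m - 1)))
        + n * ((n * p) / ((n : ℝ) - p - 1)) - n * (p + 1)) ∧
    -- training error plus expected optimism is RAICc plus a term free of the restrictions, and it
    -- is an unbiased estimator of the expected test error
    (∀ᵐ ω ∂P, trainErr R r (X ω) (y ω) + ∫ ω₁, optimism P' X' y' R r (X ω₁) (y ω₁) ∂P =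
      raicc R r (X ω) (y ω) + restrictionFree (X ω)) ∧
    Integrable (fun ω => raicc R r (X ω) (y ω) + restrictionFree (X ω)) P ∧
    (∫ ω, (raicc R r (X ω) (y ω) + restrictionFree (X ω)) ∂P =
      ∫ ω, testErr P' X' y' R r (X ω) (y ω) ∂P) := by
  intro X y X' y'
  subst hβ₀
  have hn₀ : 0 < n := by lia
  have hX : ∀ᵐ ω ∂P, ((X ω)ᵀ * X ω).PosDef := htrain.ae_posDef_gram hS₀ (by lia)
  have hrss := htrain.ae_rss_pos hS₀ hσ₀ hR (by lia) (by lia) β₀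
  have htrainErr := htrain.integrable_trainErr hS₀ hσ₀ hR hn hnm β₀
  have hopt := htrain.hasIntegral_optimism hnew hS₀ hσ₀ hR hn hnm β₀
  have htestErr := HasIntegral.add ⟨htrainErr, rfl⟩ hopt
  simp only [optimism, add_sub_cancel] at htestErr
  have hcrit : (fun ω => trainErr R (R *ᵥ β₀) (X ω) (y ω) +
      ∫ ω₁, optimism P' X' y' R (R *ᵥ β₀) (X ω₁) (y ω₁) ∂P) =ᵐ[P]
        fun ω => raicc R (R *ᵥ β₀) (X ω) (y ω) + restrictionFree (X ω) := by
    filter_upwards [hX, hrss] with ω hX hrss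
    rw [hopt.2, trainErr_add_eq_raicc_add_restrictionFree hX hR hn₀ hrss]
  have hunbiased := (HasIntegral.add ⟨htrainErr, rfl⟩ (hasIntegral_const _)).congr hcrit
  refine ⟨?_, ?_, htestErr.1, htrainErr, hopt.2, hcrit, hunbiased.1, ?_⟩
  · filter_upwards [hX, hrss] with ω hX hrss θ
    exact isRestrictedMLE_iff hX hR hn₀ hrss
  · filter_upwards [hX, hrss] with ω hX hrss
    exact hnew.integrable_negTwoLogLik_mle hS₀.posSemidef hσ₀.le hn₀ hX hR hrss β₀
  · rw [hunbiased.2, htestErr.2, hopt.2]
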